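/- \textbf{Setting.} Let $px$ be a non-degenerate symmetric bilinear form on $\mathbb{R}^d$ and let $K\nearrow\mathbb{R}^d$ be a family of (coordinate-parallel) cuboids centered at zero, all of whose edge lengths tend to infinity. For a bounded continuous function $g$ on $\mathbb{R}^d$ let $\tilde g(p)=(2\pi)^{-d/2}\int e^{-ipx}g(x)\,d^dx$ be its Fourier transform as a tempered distribution. \textbf{Spectral notions.} Let $x\mapsto\gamma_x$ be a group of isometries of a Banach space $X$, indexed by $\mathbb{R}^d$, and let $X_*$ be a linear space of bounded functionals on $X$ such that the functions $g_{\varphi,A}(x):=\varphi(\gamma_x(A))$, $A\in X$, $\varphi\in X_*$, are continuous; let $\hat X_*\subset X_*$ be a norm dense subspace. For a subspace $Y\subset X$ put $\mathrm{Sp}\,\gamma|_Y:=\overline{\bigcup_{A\in Y,\varphi\in X_*}\mathrm{supp}\,\tilde g_{\varphi,A}}$, $\mathrm{Sp}\,\gamma:=\mathrm{Sp}\,\gamma|_X$, and define \begin{itemize} \item $\mathrm{Sp}_{\mathrm{pp}}\gamma$ as the set of all $q\in\mathrm{Sp}\,\gamma$ for which there is $0\neq A\in X$ with $\mathrm{supp}\,\tilde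 g_{\varphi,A}\subset\{q\}$ for all $\varphi\in X_*$; \item $X_{\mathrm c}:=\{A\in X\mid \lim_{K\nearrow\mathbb{R}^d}|K|^{-1}\int_K e^{-iqx}\varphi(\gamma_x(A))\,d^dx=0\ \ \forall q\in\mathbb{R}^d,\varphi\in X_*\}$ and $\mathrm{Sp}_{\mathrm c}\gamma:=\mathrm{Sp}\,\gamma|_{X_{\mathrm c}}$; \item $X_{\mathrm{ac}}$ as the norm closure of $\{A\in X_{\mathrm c}\mid \tilde g_{\varphi,A}\in L^1(\mathbb{R}^d)\ \forall\varphi\in\hat X_*\}$ and $\mathrm{Sp}_{\mathrm{ac}}\gamma:=\mathrm{Sp}\,\gamma|_{X_{\mathrm{ac}}}$; \item $X_{\mathrm{sc}}:=X_{\mathrm c}/X_{\mathrm{ac}}$ and $\mathrm{Sp}_{\mathrm{sc}}\gamma:=\overline{\bigcup_{A\in X_{\mathrm c},\,\varphi\in X_{\mathrm{sc}}^*}\mathrm{supp}\,\tilde h_{\varphi,A}}$, where $h_{\varphi,A}(x)=\varphi([\gamma_x(A)])$. \end{itemize} \textbf{Theorem.} Let $\mathfrak{A}$ be a unital C*-algebra,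 $\mathbb{R}^d\ni x\mapsto\alpha_x$ a strongly continuous group of automorphisms of $\mathfrak{A}$, $\omega_0$ a pure state on $\mathfrak{A}$ with GNS representation $(\pi,\mathcal{H},\Omega)$, and let $\mathfrak{A}_*\subset\mathfrak{A}^*$ be the predual of this representation, i.e. the norm closed linear span of the functionals $(\Psi|\pi(\,\cdot\,)\Phi)$, $\Psi,\Phi\in\mathcal{H}$. Assume that $\|A\|=\sup\{|\varphi(A)| : \varphi\in\mathfrak{A}_*,\|\varphi\|\leq 1\}$ for all $A\in\mathfrak{A}$ (i.e. $\pi$ is faithful) and that $\ker\omega_0\subset\mathfrak{A}_{\mathrm c}$. Let $\hat{\mathfrak{A}}\subset\mathfrak{A}$ be a norm dense subspace and let $\hat{\mathfrak{A}}_*\subset\mathfrak{A}_*$ be a norm dense subspace which is self-adjoint (with $\varphi$ it contains $\overline{\varphi}$, $\overline{\varphi}(A)=\overline{\varphi(A^*)}$) and contains all the functionals $(\Psi|\pi(\,\cdot\,)\Omega)$ with $\Psi$ in some dense subspace of $\mathcal{H}$. The spectra of $\alpha$ are defined with $X=\mathfrak{A}$, $X_*=\mathfrak{A}_*$, $\hat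 X_*=\hat{\mathfrak{A}}_*$; those of the transposed action $\alpha^*_x\varphi=\varphi\circ\alpha_x$ with $X=\mathfrak{A}_*$, $X_*=\mathfrak{A}$, $\hat X_*=\hat{\mathfrak{A}}$ (acting by evaluation); those of a unitary group $U$ on $\mathcal{H}$ with $X=\mathcal{H}$, $X_*=\hat X_*=\mathcal{H}^*$. Then there is a unique strongly continuous group of unitaries $\mathbb{R}^d\ni x\mapsto U(x)$ on $\mathcal{H}$ with $\pi(\alpha_x(A))=U(x)\pi(A)U(x)^{-1}$ and $U(x)\Omega=\Omega$ for all $x\in\mathbb{R}^d$, $A\in\mathfrak{A}$, and there hold the relations: \begin{enumerate} \item[(a)] $\mathrm{Sp}_{\mathrm{pp}}U=\mathrm{Sp}_{\mathrm{pp}}\alpha=\mathrm{Sp}_{\mathrm{pp}}\alpha^*=\{0\}$; \item[(b)] $\mathrm{Sp}_{\mathrm c}U-\mathrm{Sp}_{\mathrm c}U\subset\mathrm{Sp}_{\mathrm c}\alpha$; \item[(c)] $\pm\mathrm{Sp}_{\mathrm{ac}}U\subset\mathrm{Sp}_{\mathrm{ac}}\alpha^*$; \item[(d)] $\pm\mathrm{Sp}_{\mathrm{sc}}U\subset\mathrm{Sp}_{\mathrm{sc}}\alpha$.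 \end{enumerate} -/

import Mathlib

open MeasureTheory Filter Topology
open scoped ComplexOrder InnerProductSpace SchwartzMap Pointwise

noncomputable section

namespace ArvesonSpectral

/-- The group `ℝ^d` (and the space of momenta). -/
abbrev E (d : ℕ) : Type := EuclideanSpace ℝ (Fin d)

/-! ### Fourier transforms of functions `x ↦ φ(α_x(A))` as tempered distributions -/

/-- The distributional Fourier transform
`g̃(p) = (2π)^{-d/2} ∫ e^{-ipx} g(x) dx` of a bounded continuous function `g`, evaluated on the
test function `f`; here `px = β p x`. -/
def fourierPairing {d : ℕ} (β : LinearMap.BilinForm ℝ (E d)) (g : E d → ℂ) (f : 𝓢(E d, ℂ)) : ℂ :=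
  (((2 * Real.pi) ^ (-(d : ℝ) / 2) : ℝ) : ℂ) *
    ∫ x, g x * ∫ p, Complex.exp (-(Complex.I * (β p x : ℂ))) * f p

/-- The support of the distribution `g̃`. -/
def fourierSupport {d : ℕ} (β : LinearMap.BilinForm ℝ (E d)) (g : E d → ℂ) : Set (E d) :=
  Distribution.dsupport (fourierPairing β g)

/-- The distribution `g̃` is (given by) a function in `L¹(ℝ^d, d^dp)`. -/
def FourierInL1 {d : ℕ} (β : LinearMap.BilinForm ℝ (E d)) (g : E d → ℂ) : Prop :=
  ∃ h : E d → ℂ, Integrable h ∧ ∀ f : 𝓢(E d, ℂ), fourierPairing β g f = ∫ p, h p * f p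

/-! ### Families of cuboids -/

/-- The cuboid centered at zero with edge lengths `2 L i`. -/
def cuboid {d : ℕ} (L : Fin d → ℝ) : Set (E d) := {x | ∀ i, |x i| ≤ L i}

/-- A family of cuboids `K ↗ ℝ^d`, centered at zero, all of whose edge lengths tend to infinity;
it is recorded by the filter generated by the tails of the family on the space of half edge
lengths. -/
structure CuboidFamily (d : ℕ) where
  filter : Filter (Fin d → ℝ)
  neBot : filter.NeBot
  tendsto_atTop : ∀ i, Tendsto (fun L : Fin d → ℝ => L i) filter atTop

/-- The average of `g` over the cuboid with half edge lengths `L`. -/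
def cuboidMean {d : ℕ} (L : Fin d → ℝ) (g : E d → ℂ) : ℂ :=
  ((volume.real (cuboid L))⁻¹ : ℝ) * ∫ x in cuboid L, g x

/-! ### Groups of isometries -/

/-- A group of isometries `ℝ^d ∋ x ↦ act x` of `X`, together with a subspace `fn` of functionals
with respect to which it is weakly continuous. -/
structure IsometricFlow (d : ℕ) (X : Type*) [NormedAddCommGroup X] [NormedSpace ℂ X] where
  act : E d → X →ₗᵢ[ℂ] X
  act_zero : ∀ A, act 0 A = A
  act_add : ∀ x y A, act (x + y) A = act x (act y A)
  fn : Submodule ℂ (StrongDual ℂ X)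
  continuous_fn : ∀ φ ∈ fn, ∀ A, Continuous fun x => φ (act x A)

/-! Helper facts, needed for the continuous subspace to be an invariant linear subspace. -/

lemma isClosed_cuboid {d : ℕ} (L : Fin d → ℝ) : IsClosed (cuboid L) := by
  simp only [cuboid, Set.ofPred_forall]
  exact isClosed_iInter fun i => isClosed_le (by fun_prop) continuous_const

lemma cuboid_eq_preimage {d : ℕ} (L : Fin d → ℝ) :
    cuboid L = (@WithLp.ofLp 2 (Fin d → ℝ)) ⁻¹' Set.Icc (-L) L := by
  ext x
  simp [cuboid, abs_le, Pi.le_def, forall_and]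

lemma isCompact_cuboid {d : ℕ} (L : Fin d → ℝ) : IsCompact (cuboid L) := by
  rw [cuboid_eq_preimage]
  exact (PiLp.homeomorph 2 (fun _ : Fin d => ℝ)).isCompact_preimage.2 isCompact_Icc

lemma volume_cuboid {d : ℕ} {L : Fin d → ℝ} (hL : ∀ i, 0 ≤ L i) :
    volume.real (cuboid L) = ∏ i, (2 * L i) := by
  rw [cuboid_eq_preimage, Measure.real,
    (PiLp.volume_preserving_ofLp (Fin d)).measure_preimage measurableSet_Icc.nullMeasurableSet,
    Real.volume_Icc_pi_toReal (fun i => by have := hL i; simp; linarith)]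
  refine Finset.prod_congr rfl fun i _ => ?_
  simp; ring

lemma integrableOn_cuboid {d : ℕ} (L : Fin d → ℝ) {g : E d → ℂ} (hg : Continuous g) :
    IntegrableOn g (cuboid L) := hg.continuousOn.integrableOn_compact (isCompact_cuboid L)

lemma cuboidMean_add {d : ℕ} (L : Fin d → ℝ) {g h : E d → ℂ} (hg : Continuous g)
    (hh : Continuous h) :
    cuboidMean L (fun x => g x + h x) = cuboidMean L g + cuboidMean L h := by
  simp only [cuboidMean]
  rw [integral_add (integrableOn_cuboid L hg) (integrableOn_cuboid L hh), mul_add]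

lemma cuboidMean_const_mul {d : ℕ} (L : Fin d → ℝ) (c : ℂ) (g : E d → ℂ) :
    cuboidMean L (fun x => c * g x) = c * cuboidMean L g := by
  simp only [cuboidMean]
  rw [integral_const_mul]; ring

/-- Translations do not change the limit of the means of a bounded function. -/
lemma tendsto_cuboidMean_translate {d : ℕ} (K : CuboidFamily d) {g : E d → ℂ} (hg : Continuous g)
    {C : ℝ} (hC : ∀ x, ‖g x‖ ≤ C) (h0 : Tendsto (fun L => cuboidMean L g) K.filter (𝓝 0))
    (y : E d) : Tendsto (fun L => cuboidMean L (fun x => g (x + y))) K.filter (𝓝 0) := by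
  have hratio : Tendsto (fun L : Fin d → ℝ => 2 * C * (1 - ∏ i, (1 - |y i| * (L i)⁻¹)))
      K.filter (𝓝 0) := by
    have h1 : ∀ i, Tendsto (fun L : Fin d → ℝ => 1 - |y i| * (L i)⁻¹) K.filter (𝓝 1) := by
      intro i
      simpa using tendsto_const_nhds.sub
        ((tendsto_inv_atTop_zero.comp (K.tendsto_atTop i)).const_mul |y i|)
    have h2 := tendsto_finsetProd Finset.univ fun i _ => h1 i
    simpa using ((tendsto_const_nhds (x := (1 : ℝ))).sub h2).const_mul (2 * C)
  have hdiff : Tendsto (fun L => cuboidMean L (fun x => g (x + y)) - cuboidMean L g)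
      K.filter (𝓝 0) := by
    refine squeeze_zero_norm' ?_ hratio
    have hev : ∀ᶠ L in K.filter, ∀ i, |y i| + 1 ≤ L i :=
      eventually_all.2 fun i => (K.tendsto_atTop i).eventually_ge_atTop _
    filter_upwards [hev] with L hL
    have hLpos : ∀ i, 0 < L i := fun i => by have := hL i; have := abs_nonneg (y i); linarith
    set L' : Fin d → ℝ := fun i => L i - |y i| with hL'
    have hL'0 : ∀ i, 0 ≤ L' i := fun i => by have := hL i; simp only [hL']; linarith
    set T : Set (E d) := (fun x => x + y) '' cuboid L with hT
    have hTpre : T = (fun x => x - y) ⁻¹' cuboid L := by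
      simp [hT, sub_eq_add_neg]
    have hTc : IsCompact T := (isCompact_cuboid L).image (by fun_prop)
    have hTm : MeasurableSet T := hTc.measurableSet
    have hKm : MeasurableSet (cuboid L) := (isClosed_cuboid L).measurableSet
    have hK'm : MeasurableSet (cuboid L') := (isClosed_cuboid L').measurableSet
    have hTvol : volume.real T = volume.real (cuboid L) := by
      rw [hTpre, Measure.real, Measure.real]
      congr 1
      exact (measurePreserving_sub_right volume y).measure_preimage hKm.nullMeasurableSet
    have hsubK : cuboid L' ⊆ cuboid L := fun x hx i => by
      have := hx i; have := abs_nonneg (y i); simp only [hL'] at *; linarith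
    have hsubT : cuboid L' ⊆ T := by
      rw [hTpre]
      intro x hx i
      have h1 := hx i
      have h2 := abs_sub (x i) (y i)
      simp only [hL'] at h1
      simp only [PiLp.sub_apply]
      linarith
    have hshift : ∫ x in cuboid L, g (x + y) = ∫ x in T, g x := by
      rw [hT]
      exact ((measurePreserving_add_right volume y).setIntegral_image_emb
        (MeasurableEquiv.addRight y).measurableEmbedding g (cuboid L)).symm
    have hfin : ∀ {s : Set (E d)}, IsCompact s → volume s ≠ ⊤ := fun hs => hs.measure_lt_top.ne
    have hb : ∀ {s : Set (E d)}, IsCompact s → MeasurableSet s → cuboid L' ⊆ s →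
        ‖∫ x in s \ cuboid L', g x‖ ≤ C * (volume.real s - volume.real (cuboid L')) := by
      intro s hs hsm hsub
      rw [← measureReal_sdiff hsub hK'm (hfin hs)]
      refine norm_setIntegral_le_of_norm_le_const ?_ (fun x _ => hC x)
      exact (measure_mono Set.sdiff_subset).trans_lt hs.measure_lt_top
    have hsplit : ∀ {s : Set (E d)}, IsCompact s → cuboid L' ⊆ s →
        ∫ x in s, g x = (∫ x in s \ cuboid L', g x) + ∫ x in cuboid L', g x := by
      intro s hs hsub
      rw [setIntegral_sdiff hK'm (hg.continuousOn.integrableOn_compact hs) hsub]; ring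
    have hmain : ‖(∫ x in cuboid L, g (x + y)) - ∫ x in cuboid L, g x‖ ≤
        2 * C * (volume.real (cuboid L) - volume.real (cuboid L')) := by
      rw [hshift, hsplit hTc hsubT, hsplit (isCompact_cuboid L) hsubK, add_sub_add_right_eq_sub]
      have h1 := hb hTc hTm hsubT
      have h2 := hb (isCompact_cuboid L) hKm hsubK
      rw [hTvol] at h1
      calc _ ≤ _ := norm_sub_le _ _
        _ ≤ _ := add_le_add h1 h2
        _ = _ := by ring
    have hvpos : 0 < volume.real (cuboid L) := by
      rw [volume_cuboid fun i => (hLpos i).le]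
      exact Finset.prod_pos fun i _ => by have := hLpos i; positivity
    have hv' : volume.real (cuboid L') =
        volume.real (cuboid L) * ∏ i, (1 - |y i| * (L i)⁻¹) := by
      rw [volume_cuboid fun i => (hLpos i).le, volume_cuboid hL'0, ← Finset.prod_mul_distrib]
      refine Finset.prod_congr rfl fun i _ => ?_
      have := (hLpos i).ne'
      simp only [hL']
      field_simp
    simp only [cuboidMean]
    rw [← mul_sub, norm_mul, Complex.norm_real, Real.norm_of_nonneg (by positivity)]
    calc _ ≤ (volume.real (cuboid L))⁻¹ *
          (2 * C * (volume.real (cuboid L) - volume.real (cuboid L'))) := by gcongr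
      _ = _ := by rw [hv']; field_simp
  simpa using hdiff.add h0

namespace IsometricFlow

variable {d : ℕ} {X : Type*} [NormedAddCommGroup X] [NormedSpace ℂ X]

/-- The Arveson spectrum of the flow restricted to the subspace `S`. -/
def spectrumOn (F : IsometricFlow d X) (β : LinearMap.BilinForm ℝ (E d)) (S : Submodule ℂ X) :
    Set (E d) :=
  closure (⋃ A ∈ S, ⋃ φ ∈ F.fn, fourierSupport β fun x => φ (F.act x A))

/-- The spectral subspace (inside `S`) of a closed set `Δ`. -/
def spectralSubspace (F : IsometricFlow d X) (β : LinearMap.BilinForm ℝ (E d))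
    (S : Submodule ℂ X) (Δ : Set (E d)) : Set X :=
  {A | A ∈ S ∧ ∀ φ ∈ F.fn, fourierSupport β (fun x => φ (F.act x A)) ⊆ Δ}

/-- The pure-point spectrum of the flow restricted to `S`. -/
def ppSpectrum (F : IsometricFlow d X) (β : LinearMap.BilinForm ℝ (E d)) (S : Submodule ℂ X) :
    Set (E d) :=
  {q | q ∈ F.spectrumOn β S ∧ ∃ A ∈ F.spectralSubspace β S {q}, A ≠ 0}

/-- `A` has vanishing means `|K|⁻¹ ∫_K e^{-iqx} φ(α_x(A)) dx → 0` for all `q` and `φ`. -/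
def HasZeroMeans (F : IsometricFlow d X) (β : LinearMap.BilinForm ℝ (E d)) (K : CuboidFamily d)
    (A : X) : Prop :=
  ∀ q : E d, ∀ φ ∈ F.fn, Tendsto
    (fun L => cuboidMean L fun x => Complex.exp (-(Complex.I * (β q x : ℂ))) * φ (F.act x A))
    K.filter (𝓝 0)

lemma continuous_phase (β : LinearMap.BilinForm ℝ (E d)) (q : E d) :
    Continuous fun x : E d => Complex.exp (-(Complex.I * (β q x : ℂ))) := by
  have : Continuous fun x : E d => β q x := (β q).continuous_of_finiteDimensional
  fun_prop

lemma continuous_integrand (F : IsometricFlow d X) (β : LinearMap.BilinForm ℝ (E d)) (q : E d)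
    {φ : StrongDual ℂ X} (hφ : φ ∈ F.fn) (A : X) :
    Continuous fun x => Complex.exp (-(Complex.I * (β q x : ℂ))) * φ (F.act x A) :=
  (continuous_phase β q).mul (F.continuous_fn φ hφ A)

/-- The continuous subspace of the flow. -/
def continuousSubspace (F : IsometricFlow d X) (β : LinearMap.BilinForm ℝ (E d))
    (K : CuboidFamily d) : Submodule ℂ X where
  carrier := {A | F.HasZeroMeans β K A}
  zero_mem' := fun q φ _ => by simpa [cuboidMean] using tendsto_const_nhds
  add_mem' := fun {A B} hA hB q φ hφ => by
    have h := (hA q φ hφ).add (hB q φ hφ)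
    simp only [← cuboidMean_add _ (F.continuous_integrand β q hφ A)
      (F.continuous_integrand β q hφ B), add_zero] at h
    simpa [mul_add] using h
  smul_mem' := fun c A hA q φ hφ => by
    have h := (hA q φ hφ).const_mul c
    simp only [← cuboidMean_const_mul, mul_zero] at h
    simpa [mul_left_comm] using h

/-- The continuous subspace is invariant. -/
lemma act_mem_continuousSubspace (F : IsometricFlow d X) (β : LinearMap.BilinForm ℝ (E d))
    (K : CuboidFamily d) (y : E d) {A : X} (hA : A ∈ F.continuousSubspace β K) :
    F.act y A ∈ F.continuousSubspace β K := by
  intro q φ hφ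
  have hb : ∀ x, ‖Complex.exp (-(Complex.I * (β q x : ℂ))) * φ (F.act x A)‖ ≤ ‖φ‖ * ‖A‖ := by
    intro x
    have h1 : ‖Complex.exp (-(Complex.I * (β q x : ℂ)))‖ = 1 := by simp [Complex.norm_exp]
    have h2 := φ.le_opNorm (F.act x A)
    rw [LinearIsometry.norm_map] at h2
    rwa [norm_mul, h1, one_mul]
  have h := (tendsto_cuboidMean_translate K (F.continuous_integrand β q hφ A) hb
    (hA q φ hφ) y).const_mul (Complex.exp (Complex.I * (β q y : ℂ)))
  simp only [← cuboidMean_const_mul, mul_zero] at h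
  refine h.congr fun L => ?_
  congr 1
  funext x
  rw [F.act_add, ← mul_assoc, ← Complex.exp_add, map_add]
  congr 2
  push_cast
  ring

/-- The continuous spectrum of the flow restricted to `S`. -/
def cSpectrum (F : IsometricFlow d X) (β : LinearMap.BilinForm ℝ (E d)) (K : CuboidFamily d)
    (S : Submodule ℂ X) : Set (E d) :=
  F.spectrumOn β (S ⊓ F.continuousSubspace β K)

/-- The absolutely continuous subspace (inside `S`): the norm closure of the space of all elements
`A` of the continuous subspace such that the Fourier transforms of `x ↦ φ(α_x(A))` are in `L¹` for
all `φ` in the set `G` of functionals. -/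
def acSubspace (F : IsometricFlow d X) (β : LinearMap.BilinForm ℝ (E d)) (K : CuboidFamily d)
    (S : Submodule ℂ X) (G : Submodule ℂ (StrongDual ℂ X)) : Submodule ℂ X :=
  (Submodule.span ℂ {A | A ∈ S ⊓ F.continuousSubspace β K ∧
    ∀ φ ∈ G, FourierInL1 β fun x => φ (F.act x A)}).topologicalClosure

/-- The absolutely continuous spectrum of the flow restricted to `S`. -/
def acSpectrum (F : IsometricFlow d X) (β : LinearMap.BilinForm ℝ (E d)) (K : CuboidFamily d)
    (S : Submodule ℂ X) (G : Submodule ℂ (StrongDual ℂ X)) : Set (E d) :=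
  F.spectrumOn β (F.acSubspace β K S G)

/-- The singular continuous space: the quotient of the continuous subspace by the absolutely
continuous one, with the quotient norm. -/
abbrev ScSpace (F : IsometricFlow d X) (β : LinearMap.BilinForm ℝ (E d)) (K : CuboidFamily d)
    (G : Submodule ℂ (StrongDual ℂ X)) : Type _ :=
  F.continuousSubspace β K ⧸ (F.acSubspace β K ⊤ G).submoduleOf (F.continuousSubspace β K)

/-- The class `[α_x(A)]` (the reduced group applied to `[A]`) in the singular continuous space. -/
def scClass (F : IsometricFlow d X) (β : LinearMap.BilinForm ℝ (E d)) (K : CuboidFamily d)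
    (G : Submodule ℂ (StrongDual ℂ X)) (A : F.continuousSubspace β K) (x : E d) :
    F.ScSpace β K G :=
  Submodule.Quotient.mk ⟨F.act x A, F.act_mem_continuousSubspace β K x A.2⟩

/-- The singular continuous spectrum: the Arveson spectrum of the reduced group acting on the
singular continuous space, with respect to all bounded functionals on that space. -/
def scSpectrum (F : IsometricFlow d X) (β : LinearMap.BilinForm ℝ (E d)) (K : CuboidFamily d)
    (G : Submodule ℂ (StrongDual ℂ X)) : Set (E d) :=
  closure (⋃ A : F.continuousSubspace β K, ⋃ φ : StrongDual ℂ (F.ScSpace β K G),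
    fourierSupport β fun x => φ (F.scClass β K G A x))

end IsometricFlow

/-! ### Unitary groups -/

/-- A strongly continuous group of unitaries `ℝ^d ∋ x ↦ U(x)` on a Hilbert space. -/
structure UnitaryGroup (d : ℕ) (H : Type*) [NormedAddCommGroup H] [InnerProductSpace ℂ H] where
  toFun : E d → (H ≃ₗᵢ[ℂ] H)
  map_zero : ∀ Ψ, toFun 0 Ψ = Ψ
  map_add : ∀ x y Ψ, toFun (x + y) Ψ = toFun x (toFun y Ψ)
  continuous_apply : ∀ Ψ, Continuous fun x => toFun x Ψ

/-- A unitary group as a group of isometries, with respect to all bounded functionals. -/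
def UnitaryGroup.flow {d : ℕ} {H : Type*} [NormedAddCommGroup H] [InnerProductSpace ℂ H]
    (U : UnitaryGroup d H) : IsometricFlow d H where
  act := fun x => (U.toFun x).toLinearIsometry
  act_zero := U.map_zero
  act_add := U.map_add
  fn := ⊤
  continuous_fn := fun φ _ A => φ.continuous.comp (U.continuous_apply A)

/-! ### Automorphism groups of C*-algebras and their transposed action -/

/-- A strongly continuous group of automorphisms `ℝ^d ∋ x ↦ α_x` of a unital C*-algebra. -/
structure AutomorphismGroup (d : ℕ) (𝔄 : Type*) [CStarAlgebra 𝔄] where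
  toFun : E d → (𝔄 ≃⋆ₐ[ℂ] 𝔄)
  map_zero : ∀ A, toFun 0 A = A
  map_add : ∀ x y A, toFun (x + y) A = toFun x (toFun y A)
  continuous_apply : ∀ A, Continuous fun x => toFun x A

namespace AutomorphismGroup

variable {d : ℕ} {𝔄 : Type*} [CStarAlgebra 𝔄]

/-- The automorphism `α_x` as a linear isometry. -/
def isometry (α : AutomorphismGroup d 𝔄) (x : E d) : 𝔄 ≃ₗᵢ[ℂ] 𝔄 where
  toFun := α.toFun x
  invFun := (α.toFun x).symm
  left_inv := (α.toFun x).left_inv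
  right_inv := (α.toFun x).right_inv
  map_add' := _root_.map_add (α.toFun x)
  map_smul' := _root_.map_smul (α.toFun x)
  norm_map' := fun A => StarAlgEquiv.norm_map (α.toFun x) A

/-- The group `α` as a group of isometries of `𝔄`, with respect to the functionals in `P`. -/
def flow (α : AutomorphismGroup d 𝔄) (P : Submodule ℂ (StrongDual ℂ 𝔄)) : IsometricFlow d 𝔄 where
  act := fun x => (α.isometry x).toLinearIsometry
  act_zero := α.map_zero
  act_add := α.map_add
  fn := P
  continuous_fn := fun φ _ A => φ.continuous.comp (α.continuous_apply A)

/-- A subspace of `𝔄`, viewed as a space of functionals (evaluations) on `𝔄*`. -/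
def evaluations (S : Submodule ℂ 𝔄) : Submodule ℂ (StrongDual ℂ (StrongDual ℂ 𝔄)) :=
  S.map (NormedSpace.inclusionInDoubleDual ℂ 𝔄).toLinearMap

/-- The transposed action `α*_x φ = φ ∘ α_x` on `𝔄*`, with respect to the evaluations on elements
of `𝔄`. -/
def transposed (α : AutomorphismGroup d 𝔄) : IsometricFlow d (StrongDual ℂ 𝔄) where
  act := fun x =>
    { toFun := fun φ => φ ∘L ((α.isometry x : 𝔄 ≃L[ℂ] 𝔄) : 𝔄 →L[ℂ] 𝔄)
      map_add' := fun φ ψ => rfl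
      map_smul' := fun c φ => rfl
      norm_map' := fun φ => φ.opNorm_comp_linearIsometryEquiv (α.isometry x) }
  act_zero := fun φ => by
    ext A
    exact congrArg φ (α.map_zero A)
  act_add := fun x y φ => by
    ext A
    exact congrArg φ ((congrArg (fun z => α.toFun z A) (add_comm x y)).trans (α.map_add y x A))
  fn := evaluations ⊤
  continuous_fn := by
    rintro _ ⟨A, _, rfl⟩ φ
    exact φ.continuous.comp (α.continuous_apply A)

end AutomorphismGroup

/-! ### States and GNS representations -/

/-- The set of states of a unital C*-algebra. -/
def states (𝔄 : Type*) [CStarAlgebra 𝔄] : Set (StrongDual ℂ 𝔄) :=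
  {ω | (∀ A, 0 ≤ ω (star A * A)) ∧ ω 1 = 1}

/-- A pure state is an extreme point of the set of states. -/
def IsPureState {𝔄 : Type*} [CStarAlgebra 𝔄] (ω : StrongDual ℂ 𝔄) : Prop :=
  ω ∈ Set.extremePoints ℝ (states 𝔄)

section GNS

variable {𝔄 : Type*} [CStarAlgebra 𝔄] {H : Type*} [NormedAddCommGroup H] [InnerProductSpace ℂ H]
  [CompleteSpace H]

/-- `(π, H, Ω)` is a GNS triple of `ω`: `Ω` is cyclic for `π` and induces `ω`. (Such a triple is
unique up to unitary equivalence.) -/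
structure IsGNSTriple (ω : StrongDual ℂ 𝔄) (π : 𝔄 →⋆ₐ[ℂ] (H →L[ℂ] H)) (Ω : H) : Prop where
  cyclic : Dense (Set.range fun A => π A Ω)
  inner_eq : ∀ A, ⟪Ω, π A Ω⟫_ℂ = ω A

/-- The functional `A ↦ (Ψ|π(A)Φ)`. -/
def vectorFunctional (π : 𝔄 →⋆ₐ[ℂ] (H →L[ℂ] H)) (Ψ Φ : H) : StrongDual ℂ 𝔄 :=
  LinearMap.mkContinuous
    { toFun := fun A => ⟪Ψ, π A Φ⟫_ℂ
      map_add' := fun A B => by simp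
      map_smul' := fun c A => by simp }
    (‖Ψ‖ * ‖Φ‖) (fun A => by
      calc ‖⟪Ψ, π A Φ⟫_ℂ‖ ≤ ‖Ψ‖ * ‖π A Φ‖ := norm_inner_le_norm _ _
        _ ≤ ‖Ψ‖ * (‖π A‖ * ‖Φ‖) := by gcongr; exact (π A).le_opNorm Φ
        _ ≤ ‖Ψ‖ * (‖A‖ * ‖Φ‖) := by gcongr; exact NonUnitalStarAlgHom.norm_apply_le π A
        _ = ‖Ψ‖ * ‖Φ‖ * ‖A‖ := by ring)

/-- The predual of the representation `π` (the functionals on `𝔄` which are normal in `π`): the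
norm closure in `𝔄*` of the linear span of the functionals `(Ψ|π(·)Φ)`. -/
def predual (π : 𝔄 →⋆ₐ[ℂ] (H →L[ℂ] H)) : Submodule ℂ (StrongDual ℂ 𝔄) :=
  (Submodule.span ℂ (Set.range fun v : H × H => vectorFunctional π v.1 v.2)).topologicalClosure

/-- The norm of every element of `𝔄` is determined by the functionals in `P`. -/
def IsNorming (P : Submodule ℂ (StrongDual ℂ 𝔄)) : Prop :=
  ∀ A : 𝔄, IsLUB {r : ℝ | ∃ φ ∈ P, ‖φ‖ ≤ 1 ∧ r = ‖φ A‖} ‖A‖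

/-- The condition on the subspace `Phat` of the predual: it is norm dense in the predual,
self-adjoint, and contains the functionals `(Ψ|π(·)Ω)` for `Ψ` in some dense subspace of `H`. -/
structure DenseCondition (π : 𝔄 →⋆ₐ[ℂ] (H →L[ℂ] H)) (Ω : H)
    (Phat : Submodule ℂ (StrongDual ℂ 𝔄)) : Prop where
  le_predual : Phat ≤ predual π
  dense : predual π ≤ Phat.topologicalClosure
  selfAdjoint : ∀ φ ∈ Phat, ∃ ψ ∈ Phat, ∀ A, ψ A = star (φ (star A))
  vector_mem : ∃ D : Submodule ℂ H, Dense (D : Set H) ∧ ∀ Ψ ∈ D, vectorFunctional π Ψ Ω ∈ Phat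

/-- The unitary group `U` implements `α` in the representation `π` and leaves `Ω` invariant. -/
structure Implements {d : ℕ} (α : AutomorphismGroup d 𝔄) (π : 𝔄 →⋆ₐ[ℂ] (H →L[ℂ] H)) (Ω : H)
    (U : UnitaryGroup d H) : Prop where
  covariant : ∀ x A Ψ, π (α.toFun x A) Ψ = U.toFun x (π A ((U.toFun x).symm Ψ))
  invariant : ∀ x, U.toFun x Ω = Ω

end GNS

end ArvesonSpectral

end

open ArvesonSpectral

/-!
The means of `φ (α_x A)` vanish for `A ∈ ker ω₀`, which forces `ω₀` to be invariant and yields `U`;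
moreover `H_c` is the orthogonal complement of `Ω`, since the vectors `π(A) Ω` with `ω₀(A) = 0` are
dense in it. A bounded continuous function whose Fourier transform is supported in a point is a
multiple of a character, so the eigenvalues are the frequencies with a nonzero mean, and only `0` is
possible.

For the other spectra let `Ψ, Φ ⟂ Ω`. The invariance of `Ω` turns the functions
`(Ψ|π(α_x(A))Ω)` and `(Ω|π(α_x(A))Ψ)` into matrix elements of `U(x)` and `U(-x)`, which transports
absolutely continuous and singular spectral support between `U` and `α`, `α*` up to sign. If `Ψ` and
`Φ` have spectral support near `p` and `q`, then `(Ψ|π(α_x(A))Φ)` has spectral support near `p - q`,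
and by irreducibility of `π` it is nonzero for some `A ∈ ker ω₀`; this gives the statement about
differences.
-/

noncomputable section

namespace ArvesonSpectral

open scoped FourierTransform ContDiff ComplexConjugate

/-! ### Schwartz functions -/

section SchwartzFunctions

variable {V : Type*} [NormedAddCommGroup V] [NormedSpace ℝ V]

/-- The complex conjugate of a Schwartz function; together with `schwartzNeg` it describes the
Fourier transform of a conjugate function. -/
def schwartzConj (f : 𝓢(V, ℂ)) : 𝓢(V, ℂ) :=
  SchwartzMap.postcompCLM (𝕜 := ℝ) (Complex.conjCLE : ℂ →L[ℝ] ℂ) f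

/-- The reflection `p ↦ f (-p)` of a Schwartz function. -/
def schwartzNeg (f : 𝓢(V, ℂ)) : 𝓢(V, ℂ) :=
  SchwartzMap.compCLMOfContinuousLinearEquiv ℂ (ContinuousLinearEquiv.neg ℝ) f

/-- The pointwise product of two Schwartz functions. -/
def schwartzMul (f g : 𝓢(V, ℂ)) : 𝓢(V, ℂ) :=
  SchwartzMap.pairing (ContinuousLinearMap.mul ℂ ℂ) f g

/-- The dilation `p ↦ f (t p)` of a Schwartz function, which localizes it near the origin as `t`
grows. -/
def schwartzDilate (t : ℝˣ) (f : 𝓢(V, ℂ)) : 𝓢(V, ℂ) :=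
  SchwartzMap.compCLMOfContinuousLinearEquiv ℂ (ContinuousLinearEquiv.smulLeft t) f

@[simp] lemma schwartzNeg_apply (f : 𝓢(V, ℂ)) (p : V) : schwartzNeg f p = f (-p) := rfl

@[simp] lemma schwartzConj_apply (f : 𝓢(V, ℂ)) (p : V) : schwartzConj f p = conj (f p) := rfl

@[simp] lemma schwartzMul_apply (f g : 𝓢(V, ℂ)) (p : V) : schwartzMul f g p = f p * g p := rfl

@[simp] lemma schwartzDilate_apply (t : ℝˣ) (f : 𝓢(V, ℂ)) (p : V) :
    schwartzDilate t f p = f ((t : ℝ) • p) := rfl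

lemma tsupport_schwartzConj (f : 𝓢(V, ℂ)) : tsupport (schwartzConj f) = tsupport f := by
  refine congrArg closure ?_
  ext p
  simp

lemma tsupport_schwartzNeg (f : 𝓢(V, ℂ)) : tsupport (schwartzNeg f) = -tsupport f :=
  tsupport_comp_eq_preimage f (Homeomorph.neg V)

lemma tsupport_schwartzNeg_subset_ball {f : 𝓢(V, ℂ)} {p : V} {r : ℝ}
    (hf : tsupport f ⊆ Metric.ball p r) : tsupport (schwartzNeg f) ⊆ Metric.ball (-p) r := by
  rw [tsupport_schwartzNeg, ← neg_ball]
  exact Set.neg_subset_neg.2 hf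

lemma eventually_schwartzDilate_eq_one {χ : 𝓢(V, ℂ)} (hχ : ∀ᶠ p in 𝓝 0, χ p = 1) (t : ℝˣ) :
    ∀ᶠ p in 𝓝 0, schwartzDilate t χ p = 1 := by
  have hsmul : Tendsto (fun p : V => (t : ℝ) • p) (𝓝 0) (𝓝 0) := by
    simpa only [smul_zero] using (continuous_const_smul (t : ℝ)).tendsto (0 : V)
  exact hsmul.eventually hχ

lemma hasCompactSupport_schwartzDilate {χ : 𝓢(V, ℂ)} (hχ : HasCompactSupport χ) (t : ℝˣ) :
    HasCompactSupport (schwartzDilate t χ) :=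
  hχ.comp_smul t.ne_zero

section FiniteDimensional

variable [FiniteDimensional ℝ V]

lemma exists_schwartz_eventually_eq_one {s : Set V} {p : V} (hs : s ∈ 𝓝 p) :
    ∃ f : 𝓢(V, ℂ), HasCompactSupport f ∧ tsupport f ⊆ s ∧ ∀ᶠ q in 𝓝 p, f q = 1 := by
  obtain ⟨R, hR, hRs⟩ := Metric.nhds_basis_closedBall.mem_iff.1 hs
  let η : ContDiffBump p := ⟨R / 2, R, half_pos hR, half_lt_self hR⟩
  have hηc : HasCompactSupport (Complex.ofRealCLM ∘ η) := η.hasCompactSupport.comp_left rfl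
  have hηs : tsupport (Complex.ofRealCLM ∘ η) ⊆ tsupport η := tsupport_comp_subset rfl η
  refine ⟨hηc.toSchwartzMap (Complex.ofRealCLM.contDiff.comp η.contDiff), hηc,
    hηs.trans (η.tsupport_eq.trans_subset hRs), ?_⟩
  filter_upwards [η.eventuallyEq_one] with q hq
  change ((η q : ℝ) : ℂ) = 1
  rw [hq, Pi.one_apply, Complex.ofReal_one]

lemma exists_sum_eq_of_tsupport_subset_iUnion {ι : Type*} [Fintype ι] {f : 𝓢(V, ℂ)}
    (hf : HasCompactSupport f) {s : ι → Set V} (hs : ∀ i, IsOpen (s i))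
    (hfs : tsupport f ⊆ ⋃ i, s i) :
    ∃ g : ι → 𝓢(V, ℂ), f = ∑ i, g i ∧ ∀ i, tsupport (g i) ⊆ s i := by
  obtain ⟨ρ, hρ⟩ := SmoothPartitionOfUnity.exists_isSubordinate (modelWithCornersSelf ℝ V)
    (isClosed_tsupport f) s hs hfs
  have hsmooth : ∀ i, ContDiff ℝ ∞ fun p => (ρ i p : ℂ) * f p := fun i =>
    (Complex.ofRealCLM.contDiff.comp (ρ i).contMDiff.contDiff).mul (f.smooth ⊤)
  have hcompact : ∀ i, HasCompactSupport fun p => (ρ i p : ℂ) * f p := fun i => hf.mul_left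
  refine ⟨fun i => (hcompact i).toSchwartzMap (hsmooth i), ?_, fun i => ?_⟩
  · ext p
    change f p = (∑ i, (hcompact i).toSchwartzMap (hsmooth i)) p
    rw [sum_apply]
    change f p = ∑ i, (ρ i p : ℂ) * f p
    by_cases hp : p ∈ tsupport f
    · have hρp := ρ.sum_eq_one hp
      rw [finsum_eq_sum_of_fintype] at hρp
      rw [← Finset.sum_mul, ← Complex.ofReal_sum, hρp, Complex.ofReal_one, one_mul]
    · simp [image_eq_zero_of_notMem_tsupport hp]
  · have hρi : tsupport (fun p => (ρ i p : ℂ)) ⊆ tsupport (ρ i) :=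
      tsupport_comp_subset Complex.ofReal_zero _
    exact (tsupport_mul_subset_left.trans hρi).trans (hρ i)

lemma map_eq_zero_of_disjoint_dsupport {M : Type*} [AddCommGroup M] {u : 𝓢(V, ℂ) →+ M}
    {f : 𝓢(V, ℂ)} (hf : HasCompactSupport f)
    (hfu : Disjoint (tsupport f) (Distribution.dsupport u)) : u f = 0 := by
  have hlocal : ∀ p : tsupport f, ∃ s : Set V,
      Distribution.IsVanishingOn u s ∧ IsOpen s ∧ (p : V) ∈ s := fun p =>
    (Distribution.notMem_dsupport_iff _).1 (Set.disjoint_left.1 hfu p.2)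
  choose s hus hs hps using hlocal
  obtain ⟨t, ht⟩ := IsCompact.elim_finite_subcover hf s hs
    fun p hp => Set.mem_iUnion.2 ⟨⟨p, hp⟩, hps ⟨p, hp⟩⟩
  obtain ⟨g, hfg, hg⟩ := exists_sum_eq_of_tsupport_subset_iUnion hf (fun i : t => hs i)
    (by simpa only [Set.iUnion_subtype] using ht)
  rw [hfg, map_sum]
  exact Finset.sum_eq_zero fun i _ => hus i _ (hg i)

end FiniteDimensional

end SchwartzFunctions

/-- The class of functions whose Fourier transform is considered: the continuous and bounded ones.
An unbundled predicate is convenient since the functions are given by formulas `φ (α_x A)`. -/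
def IsBoundedContinuous {V : Type*} [TopologicalSpace V] (g : V → ℂ) : Prop :=
  Continuous g ∧ ∃ C, ∀ x, ‖g x‖ ≤ C

namespace IsBoundedContinuous

lemma comp {V W : Type*} [TopologicalSpace V] [TopologicalSpace W] {g : V → ℂ}
    (hg : IsBoundedContinuous g) {φ : W → V} (hφ : Continuous φ) :
    IsBoundedContinuous fun x => g (φ x) :=
  ⟨hg.1.comp hφ, hg.2.imp fun _ h x => h (φ x)⟩

lemma integrable_mul {V : Type*} [TopologicalSpace V] [MeasurableSpace V]
    [OpensMeasurableSpace V] {μ : Measure V} {g h : V → ℂ}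
    (hg : IsBoundedContinuous g) (hh : Integrable h μ) : Integrable (fun y => g y * h y) μ := by
  obtain ⟨C, hC⟩ := hg.2
  exact hh.bdd_mul hg.1.aestronglyMeasurable (ae_of_all _ hC)

end IsBoundedContinuous

/-! ### The pairing in terms of the standard Fourier transform -/

section FrequencyEquiv

variable {V : Type*} [NormedAddCommGroup V] [InnerProductSpace ℝ V] [FiniteDimensional ℝ V]
  {β : LinearMap.BilinForm ℝ V}

/-- The linear coordinates in which a non-degenerate form `β` becomes `2π` times the inner
product, the normalization of the Fourier transform in Mathlib. -/
def frequencyEquiv (hβ : β.Nondegenerate) : V ≃L[ℝ] V :=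
  ((innerₗ V).toContPerfPair ≪≫ₗ LinearMap.toContinuousLinearMap.symm ≪≫ₗ
    (LinearMap.BilinForm.toDual β.flip hβ.flip).symm ≪≫ₗ
    LinearEquiv.smulOfNeZero ℝ V (2 * Real.pi) Real.two_pi_pos.ne').toContinuousLinearEquiv

lemma apply_frequencyEquiv (hβ : β.Nondegenerate) (p y : V) :
    β p (frequencyEquiv hβ y) = 2 * Real.pi * ⟪p, y⟫_ℝ := by
  have hdual : ∀ φ : Module.Dual ℝ V,
      β p ((LinearMap.BilinForm.toDual β.flip hβ.flip).symm φ) = φ p :=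
    LinearMap.BilinForm.apply_toDual_symm_apply (B := β.flip) (hB := hβ.flip) (v := p)
  simp [frequencyEquiv, hdual, real_inner_comm]

lemma integral_exp_neg_frequencyEquiv_mul [MeasurableSpace V] [BorelSpace V]
    (hβ : β.Nondegenerate) (f : 𝓢(V, ℂ)) (y : V) :
    ∫ p, Complex.exp (-(Complex.I * (β p (frequencyEquiv hβ y) : ℂ))) * f p = 𝓕 f y := by
  rw [SchwartzMap.fourier_coe, Real.fourier_eq']
  refine integral_congr_ae (ae_of_all _ fun p => ?_)
  simp only [apply_frequencyEquiv, smul_eq_mul]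
  congr 2
  push_cast
  ring

lemma integral_eq_abs_det_mul_integral_comp [MeasurableSpace V] [BorelSpace V] (T : V ≃L[ℝ] V)
    (F : V → ℂ) :
    ∫ x, F x = |LinearMap.det (T : V →ₗ[ℝ] V)| * ∫ y, F (T y) := by
  have hdet : LinearMap.det (T : V →ₗ[ℝ] V) ≠ 0 := T.toLinearEquiv.isUnit_det'.ne_zero
  have hmap : Measure.map T (volume : Measure V) =
      ENNReal.ofReal |(LinearMap.det (T : V →ₗ[ℝ] V))⁻¹| • volume :=
    Measure.map_linearMap_addHaar_eq_smul_addHaar volume hdet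
  have hcomp : ∫ y, F (T y) = ∫ x, F x ∂(Measure.map T volume) :=
    (T.toHomeomorph.measurableEmbedding.integral_map F).symm
  rw [hcomp, hmap, integral_smul_measure, ENNReal.toReal_ofReal (abs_nonneg _), abs_inv,
    Complex.real_smul, ← mul_assoc, ← Complex.ofReal_mul, mul_inv_cancel₀ (abs_ne_zero.2 hdet),
    Complex.ofReal_one, one_mul]

end FrequencyEquiv

variable {d : ℕ} {β : LinearMap.BilinForm ℝ (E d)}

/-- The constant relating `fourierPairing β` to the standard Fourier transform in the coordinates
`frequencyEquiv`. -/
def pairingConst (hβ : β.Nondegenerate) : ℂ :=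
  (((2 * Real.pi) ^ (-(d : ℝ) / 2) : ℝ) : ℂ) *
    |LinearMap.det (frequencyEquiv hβ : E d →ₗ[ℝ] E d)|

lemma pairingConst_ne_zero (hβ : β.Nondegenerate) : pairingConst hβ ≠ 0 := by
  have hdet : LinearMap.det (frequencyEquiv hβ : E d →ₗ[ℝ] E d) ≠ 0 :=
    (frequencyEquiv hβ).toLinearEquiv.isUnit_det'.ne_zero
  refine mul_ne_zero ?_ ?_
  · exact_mod_cast (Real.rpow_pos_of_pos Real.two_pi_pos _).ne'
  · exact_mod_cast abs_ne_zero.2 hdet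

lemma fourierPairing_eq (hβ : β.Nondegenerate) (g : E d → ℂ) (f : 𝓢(E d, ℂ)) :
    fourierPairing β g f = pairingConst hβ * ∫ y, g (frequencyEquiv hβ y) * 𝓕 f y := by
  rw [fourierPairing, integral_eq_abs_det_mul_integral_comp (frequencyEquiv hβ), pairingConst,
    mul_assoc]
  simp only [integral_exp_neg_frequencyEquiv_mul hβ]

lemma fourierPairing_add (hβ : β.Nondegenerate) {g : E d → ℂ} (hg : IsBoundedContinuous g)
    (f₁ f₂ : 𝓢(E d, ℂ)) :
    fourierPairing β g (f₁ + f₂) = fourierPairing β g f₁ + fourierPairing β g f₂ := by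
  have hint : ∀ f : 𝓢(E d, ℂ), Integrable fun y => g (frequencyEquiv hβ y) * 𝓕 f y := fun f =>
    (hg.comp (frequencyEquiv hβ).continuous).integrable_mul (𝓕 f).integrable
  simp only [fourierPairing_eq hβ, FourierTransform.fourier_add, add_apply, mul_add]
  rw [integral_add (hint f₁) (hint f₂), mul_add]

lemma fourierPairing_eq_zero_of_disjoint (hβ : β.Nondegenerate) {g : E d → ℂ}
    (hg : IsBoundedContinuous g) {f : 𝓢(E d, ℂ)} (hfc : HasCompactSupport f)
    (hf : Disjoint (tsupport f) (fourierSupport β g)) : fourierPairing β g f = 0 :=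
  map_eq_zero_of_disjoint_dsupport
    (u := AddMonoidHom.mk' (fourierPairing β g) (fourierPairing_add hβ hg)) hfc hf

lemma notMem_closure_iUnion_fourierSupport_iff (hβ : β.Nondegenerate) {G : Set (E d → ℂ)}
    (hG : ∀ g ∈ G, IsBoundedContinuous g) (p : E d) :
    p ∉ closure (⋃ g ∈ G, fourierSupport β g) ↔
      ∃ r > 0, ∀ g ∈ G, Distribution.IsVanishingOn (fourierPairing β g) (Metric.ball p r) := by
  constructor
  · intro hp
    obtain ⟨r, hr, hball⟩ := Metric.isOpen_iff.1 isClosed_closure.isOpen_compl p hp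
    refine ⟨r, hr, fun g hgG f hf => fourierPairing_eq_zero_of_disjoint hβ (hG g hgG) ?_ ?_⟩
    · exact (isCompact_closedBall p r).of_isClosed_subset (isClosed_tsupport _)
        (hf.trans Metric.ball_subset_closedBall)
    · exact Set.disjoint_left.2 fun q hqf hqg =>
        hball (hf hqf) (subset_closure (Set.mem_biUnion hgG hqg))
  · rintro ⟨r, hr, hG₀⟩ hp
    obtain ⟨q, hq, hqG⟩ := mem_closure_iff.1 hp _ Metric.isOpen_ball (Metric.mem_ball_self hr)
    obtain ⟨g, hgG, hqg⟩ := Set.mem_iUnion₂.1 hqG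
    exact ((hG₀ g hgG).disjoint_dsupport Metric.isOpen_ball).notMem_of_mem_left hq hqg

/-! ### Reflections, conjugates and constants -/

lemma fourierPairing_conj (g : E d → ℂ) (f : 𝓢(E d, ℂ)) :
    fourierPairing β (fun x => conj (g x)) f
      = conj (fourierPairing β g (schwartzNeg (schwartzConj f))) := by
  simp only [fourierPairing, map_mul, Complex.conj_ofReal, ← integral_conj]
  congr! 4
  rw [← integral_neg_eq_self]
  refine integral_congr_ae (ae_of_all _ fun p => ?_)
  simp [← Complex.exp_conj]

lemma fourierPairing_neg (g : E d → ℂ) (f : 𝓢(E d, ℂ)) :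
    fourierPairing β (fun x => g (-x)) f = fourierPairing β g (schwartzNeg f) := by
  rw [fourierPairing, ← integral_neg_eq_self, fourierPairing]
  congr! 4 with x
  · rw [neg_neg]
  · rw [← integral_neg_eq_self]
    refine integral_congr_ae (ae_of_all _ fun p => ?_)
    simp

lemma isVanishingOn_fourierPairing_conj {g : E d → ℂ} {p : E d} {r : ℝ}
    (hg : Distribution.IsVanishingOn (fourierPairing β g) (Metric.ball (-p) r)) :
    Distribution.IsVanishingOn (fourierPairing β fun x => conj (g x)) (Metric.ball p r) := by
  intro f hf
  rw [fourierPairing_conj,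
    hg _ (tsupport_schwartzNeg_subset_ball ((tsupport_schwartzConj f).trans_subset hf)), map_zero]

lemma isVanishingOn_fourierPairing_neg {g : E d → ℂ} {p : E d} {r : ℝ}
    (hg : Distribution.IsVanishingOn (fourierPairing β g) (Metric.ball (-p) r)) :
    Distribution.IsVanishingOn (fourierPairing β fun x => g (-x)) (Metric.ball p r) := by
  intro f hf
  rw [fourierPairing_neg, hg _ (tsupport_schwartzNeg_subset_ball hf)]

lemma FourierInL1.conj {g : E d → ℂ} (hg : FourierInL1 β g) :
    FourierInL1 β (fun x => conj (g x)) := by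
  obtain ⟨h, hh, hpair⟩ := hg
  refine ⟨fun p => conj (h (-p)), Complex.conjCLE.integrable_comp_iff.2 hh.comp_neg, fun f => ?_⟩
  rw [fourierPairing_conj, hpair, ← integral_conj, ← integral_neg_eq_self]
  refine integral_congr_ae (ae_of_all _ fun p => ?_)
  simp

lemma FourierInL1.neg {g : E d → ℂ} (hg : FourierInL1 β g) :
    FourierInL1 β (fun x => g (-x)) := by
  obtain ⟨h, hh, hpair⟩ := hg
  refine ⟨fun p => h (-p), hh.comp_neg, fun f => ?_⟩
  rw [fourierPairing_neg, hpair, ← integral_neg_eq_self]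
  refine integral_congr_ae (ae_of_all _ fun p => ?_)
  simp

lemma integral_fourier_eq {V : Type*} [NormedAddCommGroup V] [InnerProductSpace ℝ V]
    [FiniteDimensional ℝ V] [MeasurableSpace V] [BorelSpace V] (f : 𝓢(V, ℂ)) :
    ∫ y, 𝓕 f y = f 0 := by
  have hinv : 𝓕⁻ (𝓕 f) 0 = f 0 := by rw [FourierTransform.fourierInv_fourier_eq]
  rw [SchwartzMap.fourierInv_coe, Real.fourierInv_eq'] at hinv
  simpa using hinv

lemma fourierPairing_const (hβ : β.Nondegenerate) (k : ℂ) (f : 𝓢(E d, ℂ)) :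
    fourierPairing β (fun _ => k) f = pairingConst hβ * (k * f 0) := by
  rw [fourierPairing_eq hβ, integral_const_mul, integral_fourier_eq]

lemma fourierSupport_const_subset (hβ : β.Nondegenerate) (k : ℂ) :
    fourierSupport β (fun _ : E d => k) ⊆ {0} := by
  intro p hp
  by_contra hne
  refine (Distribution.notMem_dsupport_iff p).2 ⟨{0}ᶜ, fun f hf => ?_,
    isOpen_compl_singleton, hne⟩ hp
  rw [fourierPairing_const hβ, image_eq_zero_of_notMem_tsupport
    (Set.subset_compl_singleton_iff.1 hf), mul_zero, mul_zero]

lemma zero_mem_fourierSupport_const (hβ : β.Nondegenerate) {k : ℂ} (hk : k ≠ 0) :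
    (0 : E d) ∈ fourierSupport β (fun _ : E d => k) := by
  refine (Distribution.mem_dsupport_iff_forall_exists_ne _).2 fun s hs hso => ?_
  obtain ⟨f, -, hfs, hf⟩ := exists_schwartz_eventually_eq_one (hso.mem_nhds hs)
  refine ⟨f, hfs, ?_⟩
  rw [fourierPairing_const hβ, hf.self_of_nhds, mul_one]
  exact mul_ne_zero (pairingConst_ne_zero hβ) hk

/-! ### Fourier transforms of Schwartz functions -/

section FourierSchwartz

variable {V : Type*} [NormedAddCommGroup V] [InnerProductSpace ℝ V] [FiniteDimensional ℝ V]
  [MeasurableSpace V] [BorelSpace V]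

/-- The modulation `p ↦ e^{-2πi⟨p,z⟩} f(p)` of a Schwartz function. It is defined by translating
the Fourier transform, which makes it evidently a Schwartz function. -/
def schwartzMod (z : V) (f : 𝓢(V, ℂ)) : 𝓢(V, ℂ) :=
  𝓕⁻ (SchwartzMap.compSubConstCLM ℂ (-z) (𝓕 f))

lemma fourier_schwartzMod (z : V) (f : 𝓢(V, ℂ)) (x : V) :
    𝓕 (schwartzMod z f) x = 𝓕 f (x + z) := by
  rw [schwartzMod, FourierTransform.fourier_fourierInv_eq, SchwartzMap.compSubConstCLM_apply,
    sub_neg_eq_add]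

lemma schwartzMod_apply (z : V) (f : 𝓢(V, ℂ)) (p : V) :
    schwartzMod z f p =
      Complex.exp (((-2 * Real.pi * ⟪p, z⟫_ℝ : ℝ) : ℂ) * Complex.I) * f p := by
  have hinv : 𝓕⁻ (𝓕 f) p = f p := by rw [FourierTransform.fourierInv_fourier_eq]
  rw [schwartzMod, ← hinv, SchwartzMap.fourierInv_coe, SchwartzMap.fourierInv_coe,
    Real.fourierInv_eq', Real.fourierInv_eq', ← integral_const_mul,
    ← integral_sub_right_eq_self _ z]
  refine integral_congr_ae (ae_of_all _ fun x => ?_)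
  simp only [SchwartzMap.compSubConstCLM_apply, sub_neg_eq_add, sub_add_cancel, smul_eq_mul]
  rw [← mul_assoc, ← Complex.exp_add, inner_sub_left, real_inner_comm p z]
  congr 2
  push_cast
  ring

lemma tsupport_schwartzMod_subset (z : V) (f : 𝓢(V, ℂ)) :
    tsupport (schwartzMod z f) ⊆ tsupport f := by
  rw [show ⇑(schwartzMod z f) = _ from funext (schwartzMod_apply z f)]
  exact tsupport_mul_subset_right

lemma fourier_schwartzDilate (t : ℝˣ) (f : 𝓢(V, ℂ)) (y : V) :
    𝓕 (schwartzDilate t f) y =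
      (|((t : ℝ) ^ Module.finrank ℝ V)⁻¹| : ℝ) * 𝓕 f ((t : ℝ)⁻¹ • y) := by
  rw [SchwartzMap.fourier_coe, SchwartzMap.fourier_coe, Real.fourier_eq', Real.fourier_eq',
    ← Complex.real_smul, ← Measure.integral_comp_smul]
  refine integral_congr_ae (ae_of_all _ fun p => ?_)
  simp only [schwartzDilate_apply]
  rw [real_inner_smul_left, real_inner_smul_right, mul_inv_cancel_left₀ t.ne_zero]

lemma integral_conj_fourier_mul_fourier_add (f g : 𝓢(V, ℂ)) (z : V) :
    ∫ x, conj (𝓕 f x) * 𝓕 g (x + z) = 𝓕 (schwartzMul (schwartzConj f) g) z := by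
  have hplancherel := SchwartzMap.integral_inner_fourier_fourier f (schwartzMod z g)
  simp only [RCLike.inner_apply, fourier_schwartzMod] at hplancherel
  simp only [mul_comm (conj _)]
  rw [hplancherel, SchwartzMap.fourier_coe, Real.fourier_eq']
  refine integral_congr_ae (ae_of_all _ fun p => ?_)
  simp only [schwartzMod_apply, schwartzMul_apply, schwartzConj_apply, smul_eq_mul]
  ring

lemma integral_mul_fourier_schwartzMod_schwartzDilate (G : V → ℂ) (b : V) (t : ℝˣ)
    (χ : 𝓢(V, ℂ)) :
    ∫ y, G y * 𝓕 (schwartzMod (-b) (schwartzDilate t χ)) y =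
      ∫ z, G ((t : ℝ) • z + b) * 𝓕 χ z := by
  simp only [fourier_schwartzMod, fourier_schwartzDilate]
  rw [← integral_add_right_eq_self _ b]
  have hscale := Measure.integral_comp_smul (volume : Measure V)
    (fun z => G ((t : ℝ) • z + b) * 𝓕 χ z) (t : ℝ)⁻¹
  have hone : |((t : ℝ) ^ Module.finrank ℝ V)⁻¹| *
      |(((t : ℝ)⁻¹) ^ Module.finrank ℝ V)⁻¹| = 1 := by
    rw [← abs_mul, ← mul_inv, ← mul_pow, mul_inv_cancel₀ t.ne_zero, one_pow, inv_one, abs_one]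
  simp only [smul_inv_smul₀ t.ne_zero] at hscale
  simp only [add_neg_cancel_right, mul_left_comm (G _)]
  rw [integral_const_mul, hscale, Complex.real_smul, ← mul_assoc, ← Complex.ofReal_mul, hone,
    Complex.ofReal_one, one_mul]

end FourierSchwartz

/-! ### Bounded functions whose Fourier transform is supported in a point -/

section PointSupport

variable {V : Type*} [NormedAddCommGroup V] [InnerProductSpace ℝ V] [FiniteDimensional ℝ V]
  [MeasurableSpace V] [BorelSpace V]

lemma tendsto_integral_norm_comp_sub_sub {ψ : V → ℂ} (hψ : Integrable ψ) :
    Tendsto (fun h => ∫ z, ‖ψ (z - h) - ψ z‖) (𝓝 0) (𝓝 0) := by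
  have hψ₁ : MemLp ψ 1 := memLp_one_iff_integrable.2 hψ
  let τ : V → C(V, V) := fun h => ⟨fun z => z - h, by fun_prop⟩
  have hτ : Continuous τ :=
    ContinuousMap.continuous_of_continuous_uncurry τ (continuous_snd.sub continuous_fst)
  have hmp : ∀ h : V, MeasurePreserving (τ h) volume volume :=
    measurePreserving_sub_right volume
  have hcont : Continuous fun h : V => Lp.compMeasurePreserving (τ h) (hmp h) hψ₁.toLp :=
    continuous_const.compMeasurePreservingLp hτ hmp ENNReal.one_ne_top
  have hnorm : ∀ h : V, ‖Lp.compMeasurePreserving (τ h) (hmp h) hψ₁.toLp - hψ₁.toLp‖ =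
      ∫ z, ‖ψ (z - h) - ψ z‖ := fun h => by
    rw [Lp.toLp_compMeasurePreserving, ← MemLp.toLp_sub, L1.norm_eq_integral_norm]
    exact integral_congr_ae
      (((hψ₁.comp_measurePreserving (hmp h)).sub hψ₁).coeFn_toLp.fun_comp norm)
  have hlim : Tendsto (fun h => ‖Lp.compMeasurePreserving (τ h) (hmp h) hψ₁.toLp - hψ₁.toLp‖)
      (𝓝 0) (𝓝 ‖Lp.compMeasurePreserving (τ 0) (hmp 0) hψ₁.toLp - hψ₁.toLp‖) :=
    ((hcont.tendsto 0).sub_const _).norm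
  simpa only [hnorm, sub_zero, sub_self, norm_zero, integral_zero] using hlim

lemma tendsto_integral_comp_smul_add_mul {G ψ : V → ℂ} (hG : IsBoundedContinuous G)
    (hψ : Integrable ψ) (b : V) :
    Tendsto (fun t : ℝ => ∫ z, G (t • z + b) * ψ z) (𝓝 0) (𝓝 (G b * ∫ z, ψ z)) := by
  obtain ⟨C, hC⟩ := hG.2
  have hGc := hG.1
  rw [← integral_const_mul]
  refine tendsto_integral_filter_of_dominated_convergence (fun z => C * ‖ψ z‖) ?_ ?_
    (hψ.norm.const_mul C) (ae_of_all _ fun z => ?_)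
  · exact Eventually.of_forall fun t =>
      (Continuous.aestronglyMeasurable (by fun_prop)).mul hψ.aestronglyMeasurable
  · refine Eventually.of_forall fun t => ae_of_all _ fun z => ?_
    rw [norm_mul]
    gcongr
    exact hC _
  · have hcont : Continuous fun t : ℝ => G (t • z + b) * ψ z := by fun_prop
    simpa only [zero_smul, zero_add] using hcont.tendsto 0

lemma tendsto_integral_comp_smul_add_mul_sub {G ψ : V → ℂ} (hG : IsBoundedContinuous G)
    (hψ : Integrable ψ) (b : V) :
    Tendsto (fun t : ℝ => (∫ z, G (t • z + b) * ψ z) - ∫ z, G (t • z) * ψ z) atTop (𝓝 0) := by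
  obtain ⟨C, hC⟩ := hG.2
  have hshift : ∀ t : ℝ, 0 < t →
      ∫ z, G (t • z + b) * ψ z = ∫ z, G (t • z) * ψ (z - t⁻¹ • b) := fun t ht => by
    rw [← integral_sub_right_eq_self _ (t⁻¹ • b)]
    simp only [smul_sub, smul_inv_smul₀ ht.ne', sub_add_cancel]
  have htrans : Tendsto (fun t : ℝ => C * ∫ z, ‖ψ (z - t⁻¹ • b) - ψ z‖) atTop (𝓝 0) := by
    have hzero : Tendsto (fun t : ℝ => t⁻¹ • b) atTop (𝓝 0) := by
      simpa only [zero_smul] using (tendsto_inv_atTop_zero (𝕜 := ℝ)).smul_const b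
    simpa only [mul_zero, Function.comp_def] using
      ((tendsto_integral_norm_comp_sub_sub hψ).comp hzero).const_mul C
  refine squeeze_zero_norm' ?_ htrans
  filter_upwards [eventually_gt_atTop 0] with t ht
  have hGt : IsBoundedContinuous fun z => G (t • z) := hG.comp (continuous_const_smul t)
  have hψt : Integrable fun z => ψ (z - t⁻¹ • b) := hψ.comp_sub_right _
  rw [hshift t ht, ← integral_sub (hGt.integrable_mul hψt) (hGt.integrable_mul hψ),
    ← integral_const_mul]
  refine norm_integral_le_of_norm_le ((hψt.sub hψ).norm.const_mul C) (ae_of_all _ fun z => ?_)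
  rw [← mul_sub, norm_mul]
  gcongr
  exact hC _

/-- Dilating a test function which is `1` near the origin changes it only away from the origin. -/
lemma integral_comp_smul_add_mul_fourier_eq {G : V → ℂ} (hG : IsBoundedContinuous G)
    (hG₀ : ∀ f : 𝓢(V, ℂ), HasCompactSupport f → 0 ∉ tsupport f → ∫ y, G y * 𝓕 f y = 0)
    {χ : 𝓢(V, ℂ)} (hχ : HasCompactSupport χ) (hχ₁ : ∀ᶠ p in 𝓝 0, χ p = 1) (b : V) (t s : ℝˣ) :
    ∫ z, G ((t : ℝ) • z + b) * 𝓕 χ z = ∫ z, G ((s : ℝ) • z + b) * 𝓕 χ z := by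
  set f := schwartzDilate t χ - schwartzDilate s χ with hf
  have hfc : HasCompactSupport f :=
    (hasCompactSupport_schwartzDilate hχ t).sub (hasCompactSupport_schwartzDilate hχ s)
  have hf₀ : 0 ∉ tsupport f := by
    rw [notMem_tsupport_iff_eventuallyEq]
    filter_upwards [eventually_schwartzDilate_eq_one hχ₁ t,
      eventually_schwartzDilate_eq_one hχ₁ s] with p ht hs
    rw [hf, sub_apply, ht, hs, sub_self, Pi.zero_apply]
  have hzero := hG₀ (schwartzMod (-b) f)
    (hfc.of_isClosed_subset (isClosed_tsupport _) (tsupport_schwartzMod_subset _ _))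
    fun h => hf₀ (tsupport_schwartzMod_subset _ _ h)
  have hfourier : ∀ y, 𝓕 (schwartzMod (-b) f) y =
      𝓕 (schwartzMod (-b) (schwartzDilate t χ)) y -
        𝓕 (schwartzMod (-b) (schwartzDilate s χ)) y := fun y => by
    simp only [fourier_schwartzMod]
    exact DFunLike.congr_fun (map_sub (FourierTransform.fourierCLM ℂ 𝓢(V, ℂ)) _ _) _
  simp only [hfourier, mul_sub] at hzero
  rw [integral_sub (hG.integrable_mul (SchwartzMap.integrable _))
    (hG.integrable_mul (SchwartzMap.integrable _)), sub_eq_zero] at hzero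
  simpa only [integral_mul_fourier_schwartzMod_schwartzDilate] using hzero

/-- The averages `∫ G (t z + b) 𝓕χ z` do not depend on `t`: they tend to `G b` as `t → 0`, and
their dependence on `b` disappears as `t → ∞`. -/
theorem eq_apply_zero_of_forall_integral_mul_fourier_eq_zero {G : V → ℂ}
    (hG : IsBoundedContinuous G)
    (hG₀ : ∀ f : 𝓢(V, ℂ), HasCompactSupport f → 0 ∉ tsupport f → ∫ y, G y * 𝓕 f y = 0) (b : V) :
    G b = G 0 := by
  obtain ⟨χ, hχ, -, hχ₁⟩ := exists_schwartz_eventually_eq_one (univ_mem : Set.univ ∈ 𝓝 (0 : V))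
  have hψ : Integrable (𝓕 χ : 𝓢(V, ℂ)) := (𝓕 χ).integrable
  have haverage : ∀ b : V, ∀ t : ℝ, 0 < t → ∫ z, G (t • z + b) * 𝓕 χ z = G b := fun b t ht => by
    have hlim := (tendsto_integral_comp_smul_add_mul hG hψ b).mono_left
      (nhdsWithin_le_nhds (s := Set.Ioi 0))
    rw [integral_fourier_eq, hχ₁.self_of_nhds, mul_one] at hlim
    refine tendsto_nhds_unique (tendsto_const_nhds.congr' ?_) hlim
    filter_upwards [self_mem_nhdsWithin] with s hs
    exact integral_comp_smul_add_mul_fourier_eq hG hG₀ hχ hχ₁ b (Units.mk0 t ht.ne')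
      (Units.mk0 s (ne_of_gt hs))
  have hdiff := tendsto_integral_comp_smul_add_mul_sub hG hψ b
  refine sub_eq_zero.1 (tendsto_nhds_unique (tendsto_const_nhds.congr' ?_) hdiff)
  filter_upwards [eventually_gt_atTop 0] with t ht
  have hzero := haverage 0 t ht
  simp only [add_zero] at hzero
  rw [haverage b t ht, hzero]

end PointSupport

section ExponentialFunctions

variable {d : ℕ} {β : LinearMap.BilinForm ℝ (E d)}

lemma eq_apply_zero_of_fourierSupport_subset_zero (hβ : β.Nondegenerate) {g : E d → ℂ}
    (hg : IsBoundedContinuous g) (hsupp : fourierSupport β g ⊆ {0}) (x : E d) : g x = g 0 := by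
  have hconst := eq_apply_zero_of_forall_integral_mul_fourier_eq_zero
    (hg.comp (frequencyEquiv hβ).continuous) (fun f hfc hf₀ => ?_) ((frequencyEquiv hβ).symm x)
  · simpa only [ContinuousLinearEquiv.apply_symm_apply, map_zero] using hconst
  · have hpair := fourierPairing_eq_zero_of_disjoint hβ hg hfc
      ((Set.disjoint_singleton_right.2 hf₀).mono_right hsupp)
    rw [fourierPairing_eq hβ] at hpair
    exact (mul_eq_zero.1 hpair).resolve_left (pairingConst_ne_zero hβ)

lemma fourierPairing_exp_neg_mul (g : E d → ℂ) (q : E d) (f : 𝓢(E d, ℂ)) :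
    fourierPairing β (fun x => Complex.exp (-(Complex.I * (β q x : ℂ))) * g x) f =
      fourierPairing β g (SchwartzMap.compSubConstCLM ℂ q f) := by
  simp only [fourierPairing]
  congr! 3 with x
  rw [mul_right_comm, mul_comm, ← integral_const_mul,
    ← integral_add_right_eq_self (fun p => Complex.exp (-(Complex.I * (β p x : ℂ))) *
      SchwartzMap.compSubConstCLM ℂ q f p) q]
  congr! 3
  rw [SchwartzMap.compSubConstCLM_apply, add_sub_cancel_right, ← mul_assoc, ← Complex.exp_add,
    map_add, LinearMap.add_apply]
  congr 2
  push_cast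
  ring

lemma fourierSupport_exp_neg_mul_subset (g : E d → ℂ) (q : E d) :
    fourierSupport β (fun x => Complex.exp (-(Complex.I * (β q x : ℂ))) * g x) ⊆
      (fun p => p + q) ⁻¹' fourierSupport β g := by
  intro p hp
  by_contra hpq
  obtain ⟨s, hs, hso, hps⟩ := (Distribution.notMem_dsupport_iff _).1 hpq
  refine (Distribution.notMem_dsupport_iff _).2
    ⟨(fun p => p + q) ⁻¹' s, fun f hf => ?_, hso.preimage (by fun_prop), hps⟩ hp
  rw [fourierPairing_exp_neg_mul]
  refine hs _ fun p' hp' => ?_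
  have htsupp : tsupport (SchwartzMap.compSubConstCLM ℂ q f) = (fun p => p - q) ⁻¹' tsupport f :=
    tsupport_comp_eq_preimage f (Homeomorph.subRight q)
  rw [htsupp] at hp'
  simpa only [Set.mem_preimage, sub_add_cancel] using hf hp'

theorem eq_exp_mul_of_fourierSupport_subset_singleton (hβ : β.Nondegenerate) {g : E d → ℂ}
    (hg : IsBoundedContinuous g) {q : E d} (hsupp : fourierSupport β g ⊆ {q}) (x : E d) :
    g x = Complex.exp (Complex.I * (β q x : ℂ)) * g 0 := by
  have hphase : IsBoundedContinuous fun x => Complex.exp (-(Complex.I * (β q x : ℂ))) * g x := by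
    refine ⟨(Complex.continuous_exp.comp (by fun_prop)).mul hg.1, ?_⟩
    obtain ⟨C, hC⟩ := hg.2
    refine ⟨C, fun x => ?_⟩
    rw [norm_mul, Complex.norm_exp]
    simpa using hC x
  have hzero : fourierSupport β (fun x => Complex.exp (-(Complex.I * (β q x : ℂ))) * g x) ⊆ {0} :=
    fun p hp => by simpa using hsupp (fourierSupport_exp_neg_mul_subset g q hp)
  have hconst := eq_apply_zero_of_fourierSupport_subset_zero hβ hphase hzero x
  rw [map_zero, Complex.ofReal_zero, mul_zero, neg_zero, Complex.exp_zero, one_mul] at hconst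
  rw [← hconst, ← mul_assoc, ← Complex.exp_add, add_neg_cancel, Complex.exp_zero, one_mul]

end ExponentialFunctions

/-! ### Smeared unitary groups -/

/-- The root of `C² - ‖f‖² = (C + κ)²` is smooth because `C` exceeds `‖f‖`, and it vanishes off the
support of `f`. -/
lemma exists_schwartzMul_add_schwartzMul_add_eq_zero {V : Type*} [NormedAddCommGroup V]
    [NormedSpace ℝ V] {f : 𝓢(V, ℂ)} (hf : HasCompactSupport f) {C : ℝ} (hC : ∀ p, ‖f p‖ < C) :
    ∃ κ : 𝓢(V, ℂ),
      schwartzMul (schwartzConj f) f + schwartzMul (schwartzConj κ) κ + ((2 * C : ℝ) : ℂ) • κ =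
        0 := by
  have hpos : ∀ p, 0 < C ^ 2 - ‖f p‖ ^ 2 := fun p =>
    sub_pos.2 (pow_lt_pow_left₀ (hC p) (norm_nonneg _) two_ne_zero)
  let k : V → ℝ := fun p => √(C ^ 2 - ‖f p‖ ^ 2) - C
  have hsmooth : ContDiff ℝ ∞ k :=
    (ContDiff.sqrt (contDiff_const.sub ((f.smooth ⊤).norm_sq ℝ)) fun p => (hpos p).ne').sub
      contDiff_const
  have hsupp : HasCompactSupport k := by
    refine hf.mono fun p hp => ?_
    contrapose! hp
    have hfp : f p = 0 := Function.notMem_support.1 hp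
    have hC₀ : 0 < C := (norm_nonneg _).trans_lt (hC p)
    simp [k, hfp, hC₀.le]
  have hsupp' : HasCompactSupport (Complex.ofRealCLM ∘ k) := hsupp.comp_left (map_zero _)
  let κ : 𝓢(V, ℂ) := hsupp'.toSchwartzMap (Complex.ofRealCLM.contDiff.comp hsmooth)
  have hκ : ∀ p, κ p = (k p : ℂ) := fun p => rfl
  refine ⟨κ, ?_⟩
  ext p
  have hroot : ‖f p‖ ^ 2 + k p ^ 2 + 2 * C * k p = 0 := by
    have hsq := Real.sq_sqrt (hpos p).le
    simp only [k]
    linear_combination hsq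
  simp only [add_apply, smul_apply, zero_apply, schwartzMul_apply, schwartzConj_apply, hκ,
    Complex.conj_ofReal, Complex.conj_mul', smul_eq_mul]
  exact_mod_cast pow_two (k p) ▸ hroot

namespace UnitaryGroup

variable {d : ℕ} {H : Type*} [NormedAddCommGroup H] [InnerProductSpace ℂ H]
  (U : UnitaryGroup d H) (T : E d →L[ℝ] E d)

lemma toFun_neg_apply (x : E d) (Ψ : H) : U.toFun x (U.toFun (-x) Ψ) = Ψ := by
  rw [← U.map_add, add_neg_cancel, U.map_zero]

lemma symm_apply (x : E d) (Ψ : H) : (U.toFun x).symm Ψ = U.toFun (-x) Ψ := by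
  rw [LinearIsometryEquiv.symm_apply_eq, toFun_neg_apply]

lemma inner_toFun_left (x : E d) (Φ Ψ : H) :
    ⟪U.toFun x Φ, Ψ⟫_ℂ = ⟪Φ, U.toFun (-x) Ψ⟫_ℂ := by
  rw [← (U.toFun x).inner_map_map Φ, toFun_neg_apply]

lemma isBoundedContinuous_inner (Φ Ψ : H) :
    IsBoundedContinuous fun x => ⟪Φ, U.toFun x Ψ⟫_ℂ := by
  refine ⟨continuous_const.inner (U.continuous_apply Ψ), ‖Φ‖ * ‖Ψ‖, fun x => ?_⟩
  exact (norm_inner_le_norm _ _).trans_eq (by rw [LinearIsometryEquiv.norm_map])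

lemma integrable_smul {h : E d → ℂ} (hh : Integrable h) (Ψ : H) :
    Integrable fun y => h y • U.toFun (T y) Ψ := by
  have hcont : Continuous fun y => U.toFun (T y) Ψ := (U.continuous_apply Ψ).comp T.continuous
  refine (hh.norm.mul_const ‖Ψ‖).mono' (hh.1.smul hcont.aestronglyMeasurable)
    (ae_of_all _ fun y => ?_)
  rw [norm_smul, LinearIsometryEquiv.norm_map]

/-- The operator `∫ f̂(y) U(T y) dy`, which localizes vectors spectrally to the support of `f`. -/
def smear (f : 𝓢(E d, ℂ)) : H →L[ℂ] H :=
  LinearMap.mkContinuous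
    { toFun := fun Ψ => ∫ y, 𝓕 f y • U.toFun (T y) Ψ
      map_add' := fun Φ Ψ => by
        simp only [_root_.map_add, smul_add]
        exact integral_add (U.integrable_smul T (𝓕 f).integrable Φ)
          (U.integrable_smul T (𝓕 f).integrable Ψ)
      map_smul' := fun c Ψ => by
        simp only [_root_.map_smul, smul_comm _ c]
        exact integral_smul c _ }
    (∫ y, ‖𝓕 f y‖) (fun Ψ => by
      change ‖∫ y, 𝓕 f y • U.toFun (T y) Ψ‖ ≤ _
      rw [← integral_mul_const]
      refine norm_integral_le_of_norm_le ((𝓕 f).integrable.norm.mul_const ‖Ψ‖)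
        (ae_of_all _ fun y => ?_)
      rw [norm_smul, LinearIsometryEquiv.norm_map])

lemma smear_apply (f : 𝓢(E d, ℂ)) (Ψ : H) :
    U.smear T f Ψ = ∫ y, 𝓕 f y • U.toFun (T y) Ψ := rfl

lemma smear_add (f g : 𝓢(E d, ℂ)) (Ψ : H) :
    U.smear T (f + g) Ψ = U.smear T f Ψ + U.smear T g Ψ := by
  simp only [smear_apply, FourierTransform.fourier_add, add_apply, add_smul]
  exact integral_add (U.integrable_smul T (𝓕 f).integrable Ψ)
    (U.integrable_smul T (𝓕 g).integrable Ψ)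

lemma smear_const_smul (c : ℂ) (f : 𝓢(E d, ℂ)) (Ψ : H) :
    U.smear T (c • f) Ψ = c • U.smear T f Ψ := by
  simp only [smear_apply, FourierTransform.fourier_smul, smul_apply, smul_assoc]
  exact integral_smul c _

lemma smear_zero (Ψ : H) : U.smear T (0 : 𝓢(E d, ℂ)) Ψ = 0 := by
  simpa only [zero_smul] using U.smear_const_smul T 0 (0 : 𝓢(E d, ℂ)) Ψ

variable [CompleteSpace H]

lemma inner_smear (f : 𝓢(E d, ℂ)) (Φ Ψ : H) :
    ⟪Φ, U.smear T f Ψ⟫_ℂ = ∫ y, 𝓕 f y * ⟪Φ, U.toFun (T y) Ψ⟫_ℂ := by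
  rw [smear_apply, ← integral_inner (U.integrable_smul T (𝓕 f).integrable Ψ)]
  simp only [inner_smul_right]

lemma integrable_conj_mul_fourier_add_mul {s : E d → ℂ} (hs : IsBoundedContinuous s)
    (f g : 𝓢(E d, ℂ)) :
    Integrable (Function.uncurry fun x z => conj (𝓕 f x) * 𝓕 g (x + z) * s z)
      (volume.prod volume) := by
  have hconj : Integrable fun x => conj (𝓕 f x) :=
    Complex.conjCLE.integrable_comp_iff.2 (𝓕 f).integrable
  have hprod : Integrable (fun q : E d × E d => conj (𝓕 f q.1) * 𝓕 g (q.1 + q.2))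
      (volume.prod volume) :=
    (measurePreserving_prod_add volume volume).integrable_comp_of_integrable
      (hconj.mul_prod (𝓕 g).integrable)
  obtain ⟨C, hC⟩ := hs.2
  exact hprod.mul_bdd (hs.1.comp continuous_snd).aestronglyMeasurable (ae_of_all _ fun q => hC q.2)

lemma inner_smear_smear (f g : 𝓢(E d, ℂ)) (Φ Ψ : H) :
    ⟪U.smear T f Φ, U.smear T g Ψ⟫_ℂ =
      ⟪Φ, U.smear T (schwartzMul (schwartzConj f) g) Ψ⟫_ℂ := by
  let s : E d → ℂ := fun z => ⟪Φ, U.toFun (T z) Ψ⟫_ℂ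
  have hs : IsBoundedContinuous s := (U.isBoundedContinuous_inner Φ Ψ).comp T.continuous
  have hdouble : ⟪U.smear T f Φ, U.smear T g Ψ⟫_ℂ =
      ∫ x, ∫ z, conj (𝓕 f x) * 𝓕 g (x + z) * s z := by
    rw [← inner_conj_symm, inner_smear, ← integral_conj]
    refine integral_congr_ae (ae_of_all _ fun x => ?_)
    simp only [map_mul, inner_conj_symm]
    rw [inner_smear, ← integral_const_mul, ← integral_add_left_eq_self _ x]
    refine integral_congr_ae (ae_of_all _ fun z => ?_)
    simp only [s, _root_.map_add, U.map_add, LinearIsometryEquiv.inner_map_map, mul_assoc]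
  rw [hdouble, integral_integral_swap (integrable_conj_mul_fourier_add_mul hs f g), inner_smear]
  simp only [integral_mul_const, integral_conj_fourier_mul_fourier_add, s]

lemma norm_smear_apply_le_of_forall_lt {f : 𝓢(E d, ℂ)} (hf : HasCompactSupport f) {C : ℝ}
    (hC : ∀ p, ‖f p‖ < C) (Ψ : H) : ‖U.smear T f Ψ‖ ≤ C * ‖Ψ‖ := by
  have hC₀ : 0 < C := (norm_nonneg _).trans_lt (hC 0)
  obtain ⟨κ, hsum⟩ := exists_schwartzMul_add_schwartzMul_add_eq_zero hf hC
  have hinner := congrArg (fun g => RCLike.re ⟪Ψ, U.smear T g Ψ⟫_ℂ) hsum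
  simp only [smear_add, smear_const_smul, smear_zero, inner_add_right, ← inner_smear_smear,
    inner_smul_right, inner_zero_right, inner_self_eq_norm_sq, _root_.map_add,
    _root_.map_zero] at hinner
  have hpythagoras : ‖U.smear T f Ψ‖ ^ 2 + ‖(C : ℂ) • Ψ + U.smear T κ Ψ‖ ^ 2 =
      (C * ‖Ψ‖) ^ 2 := by
    rw [norm_add_sq (𝕜 := ℂ), norm_smul, Complex.norm_real, Real.norm_of_nonneg hC₀.le,
      inner_smul_left, Complex.conj_ofReal]
    simp only [RCLike.re_to_complex, Complex.re_ofReal_mul] at hinner ⊢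
    linear_combination hinner
  refine le_of_sq_le_sq ?_ (by positivity)
  rw [← hpythagoras]
  exact le_add_of_nonneg_right (sq_nonneg _)

/-- Writing `C² - ‖f‖²` as a square exhibits `C² ‖Ψ‖² - ‖f(U) Ψ‖²` as a norm square. -/
lemma norm_smear_apply_le {f : 𝓢(E d, ℂ)} (hf : HasCompactSupport f) {C : ℝ}
    (hC : ∀ p, ‖f p‖ ≤ C) (Ψ : H) : ‖U.smear T f Ψ‖ ≤ C * ‖Ψ‖ := by
  have hlim : Tendsto (fun C' : ℝ => C' * ‖Ψ‖) (𝓝[>] C) (𝓝 (C * ‖Ψ‖)) :=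
    ((continuous_id.mul continuous_const).tendsto C).mono_left nhdsWithin_le_nhds
  refine ge_of_tendsto hlim ?_
  filter_upwards [self_mem_nhdsWithin] with C' hC'
  exact U.norm_smear_apply_le_of_forall_lt T hf (fun p => (hC p).trans_lt hC') Ψ

lemma fourierPairing_inner {β : LinearMap.BilinForm ℝ (E d)} (hβ : β.Nondegenerate) (Φ Ψ : H)
    (f : 𝓢(E d, ℂ)) :
    fourierPairing β (fun x => ⟪Φ, U.toFun x Ψ⟫_ℂ) f =
      pairingConst hβ * ⟪Φ, U.smear (frequencyEquiv hβ : E d →L[ℝ] E d) f Ψ⟫_ℂ := by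
  rw [fourierPairing_eq hβ, inner_smear]
  simp only [mul_comm, ContinuousLinearEquiv.coe_coe]

end UnitaryGroup

/-! ### Integrable Fourier transforms -/

section TestFunctions

variable {V : Type*} [NormedAddCommGroup V] [NormedSpace ℝ V] [FiniteDimensional ℝ V]

lemma exists_contDiff_eventually_eq_one : ∃ χ : ℕ → V → ℝ, (∀ n, ContDiff ℝ ∞ (χ n)) ∧
    (∀ n, HasCompactSupport (χ n)) ∧ (∀ n p, χ n p ∈ Set.Icc 0 1) ∧
    ∀ p, ∀ᶠ n in atTop, χ n p = 1 := by
  let χ : ℕ → ContDiffBump (0 : V) := fun n => ⟨n + 1, n + 2, by positivity, by linarith⟩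
  refine ⟨fun n => χ n, fun n => (χ n).contDiff, fun n => (χ n).hasCompactSupport,
    fun n p => ⟨(χ n).nonneg, (χ n).le_one⟩, fun p => ?_⟩
  filter_upwards [eventually_ge_atTop ⌈‖p‖⌉₊] with n hn
  refine (χ n).one_of_mem_closedBall (mem_closedBall_zero_iff.2 ?_)
  exact (Nat.ceil_le.1 hn).trans (le_add_of_nonneg_right zero_le_one)

variable [MeasurableSpace V] [BorelSpace V] {μ : Measure V} [μ.IsAddHaarMeasure]

lemma norm_convolution_normed_le (φ : ContDiffBump (0 : V)) {σ : V → ℂ} (hσ : ∀ p, ‖σ p‖ ≤ 1)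
    (p : V) : ‖convolution (φ.normed μ) σ (ContinuousLinearMap.lsmul ℝ ℝ) μ p‖ ≤ 1 := by
  rw [convolution_def, ← φ.integral_normed (μ := μ)]
  refine norm_integral_le_of_norm_le φ.integrable_normed (ae_of_all _ fun t => ?_)
  rw [ContinuousLinearMap.lsmul_apply, norm_smul, Real.norm_of_nonneg (φ.nonneg_normed t)]
  exact mul_le_of_le_one_right (φ.nonneg_normed t) (hσ _)

lemma exists_contDiff_tendsto_ae {σ : V → ℂ} (hσm : AEStronglyMeasurable σ μ)
    (hσ : ∀ p, ‖σ p‖ ≤ 1) :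
    ∃ m : ℕ → V → ℂ, (∀ n, ContDiff ℝ ∞ (m n)) ∧ (∀ n p, ‖m n p‖ ≤ 1) ∧
      ∀ᵐ p ∂μ, Tendsto (fun n => m n p) atTop (𝓝 (σ p)) := by
  have hσi : LocallyIntegrable σ μ := by
    refine (locallyIntegrable_const (1 : ℝ)).mono hσm (ae_of_all _ fun p => ?_)
    simpa using hσ p
  have hpos : ∀ n : ℕ, (0 : ℝ) < 1 / (n + 1) := fun n => Nat.one_div_pos_of_nat
  let φ : ℕ → ContDiffBump (0 : V) := fun n =>
    ⟨1 / (n + 1), 2 * (1 / (n + 1)), hpos n, lt_two_mul_self (hpos n)⟩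
  refine ⟨fun n => convolution ((φ n).normed μ) σ (ContinuousLinearMap.lsmul ℝ ℝ) μ, fun n => ?_,
    fun n => norm_convolution_normed_le (φ n) hσ, ?_⟩
  · exact (φ n).hasCompactSupport_normed.contDiff_convolution_left _ (φ n).contDiff_normed hσi
  · refine ContDiffBump.ae_convolution_tendsto_right_of_locallyIntegrable (K := 2) ?_
      (Eventually.of_forall fun n => le_rfl) hσi
    simpa only [mul_zero] using (tendsto_one_div_add_atTop_nhds_zero_nat (𝕜 := ℝ)).const_mul 2

lemma exists_schwartz_tendsto_ae {σ : V → ℂ} (hσm : AEStronglyMeasurable σ μ)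
    (hσ : ∀ p, ‖σ p‖ ≤ 1) :
    ∃ f : ℕ → 𝓢(V, ℂ), (∀ n, HasCompactSupport (f n)) ∧ (∀ n p, ‖f n p‖ ≤ 1) ∧
      ∀ᵐ p ∂μ, Tendsto (fun n => f n p) atTop (𝓝 (σ p)) := by
  obtain ⟨m, hmsmooth, hm, hmlim⟩ := exists_contDiff_tendsto_ae hσm hσ
  obtain ⟨χ, hχsmooth, hχsupp, hχ, hχone⟩ := exists_contDiff_eventually_eq_one (V := V)
  have hsupp : ∀ n, HasCompactSupport fun p => (χ n p : ℂ) * m n p := fun n =>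
    ((hχsupp n).comp_left (g := Complex.ofReal) Complex.ofReal_zero).mul_right
  refine ⟨fun n => (hsupp n).toSchwartzMap
    ((Complex.ofRealCLM.contDiff.comp (hχsmooth n)).mul (hmsmooth n)), hsupp, fun n p => ?_, ?_⟩
  · change ‖(χ n p : ℂ) * m n p‖ ≤ 1
    rw [norm_mul, Complex.norm_real, Real.norm_of_nonneg (hχ n p).1]
    exact mul_le_one₀ (hχ n p).2 (norm_nonneg _) (hm n p)
  · filter_upwards [hmlim] with p hp
    refine hp.congr' ?_
    filter_upwards [hχone p] with n hn
    change m n p = (χ n p : ℂ) * m n p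
    rw [hn, Complex.ofReal_one, one_mul]

/-- Test the function against approximations of its conjugate phase. -/
theorem integral_norm_le_of_forall_schwartz {h : V → ℂ} (hh : Integrable h μ) {C : ℝ}
    (hC : ∀ f : 𝓢(V, ℂ), HasCompactSupport f → (∀ p, ‖f p‖ ≤ 1) → ‖∫ p, h p * f p ∂μ‖ ≤ C) :
    ∫ p, ‖h p‖ ∂μ ≤ C := by
  let σ : V → ℂ := fun p => conj (h p) * ((‖h p‖⁻¹ : ℝ) : ℂ)
  have hσ : ∀ p, ‖σ p‖ ≤ 1 := fun p => by
    simp only [σ, norm_mul, RCLike.norm_conj, Complex.norm_real, norm_inv, norm_norm]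
    exact mul_inv_le_one
  have hσm : AEStronglyMeasurable σ μ :=
    (Complex.continuous_conj.comp_aestronglyMeasurable hh.1).mul
      (Complex.continuous_ofReal.comp_aestronglyMeasurable
        hh.1.norm.aemeasurable.inv.aestronglyMeasurable)
  have hphase : ∀ p, h p * σ p = (‖h p‖ : ℂ) := fun p => by
    rw [← mul_assoc, Complex.mul_conj', Complex.ofReal_inv, sq, mul_self_mul_inv]
  obtain ⟨f, hfsupp, hf, hflim⟩ := exists_schwartz_tendsto_ae hσm hσ
  have hlim : Tendsto (fun n => ∫ p, h p * f n p ∂μ) atTop (𝓝 (∫ p, (‖h p‖ : ℂ) ∂μ)) := by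
    refine tendsto_integral_of_dominated_convergence (fun p => ‖h p‖)
      (fun n => hh.1.mul (f n).continuous.aestronglyMeasurable) hh.norm
      (fun n => ae_of_all _ fun p => ?_) ?_
    · rw [norm_mul]
      exact mul_le_of_le_one_right (norm_nonneg _) (hf n p)
    · filter_upwards [hflim] with p hp
      rw [← hphase p]
      exact hp.const_mul _
  have hle := le_of_tendsto hlim.norm (Eventually.of_forall fun n => hC (f n) (hfsupp n) (hf n))
  rw [integral_complex_ofReal, Complex.norm_real] at hle
  exact (Real.le_norm_self _).trans hle

end TestFunctions

lemma tendsto_integral_mul_of_tendsto_L1 {α ι : Type*} [MeasurableSpace α] {μ : Measure α}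
    {l : Filter ι} {F : ι → α →₁[μ] ℂ} {G : α →₁[μ] ℂ} (hF : Tendsto F l (𝓝 G)) {f : α → ℂ}
    (hfm : AEStronglyMeasurable f μ) {C : ℝ} (hC : ∀ p, ‖f p‖ ≤ C) :
    Tendsto (fun n => ∫ p, F n p * f p ∂μ) l (𝓝 (∫ p, G p * f p ∂μ)) := by
  have hint : ∀ F : α →₁[μ] ℂ, Integrable (fun p => F p * f p) μ := fun F =>
    (L1.integrable_coeFn F).mul_bdd hfm (ae_of_all _ hC)
  have hlim : Tendsto (fun n => C * ‖F n - G‖) l (𝓝 0) := by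
    simpa only [mul_zero] using (tendsto_iff_norm_sub_tendsto_zero.1 hF).const_mul C
  refine tendsto_iff_norm_sub_tendsto_zero.2
    (squeeze_zero (fun _ => norm_nonneg _) (fun n => ?_) hlim)
  rw [← integral_sub (hint _) (hint _), L1.norm_eq_integral_norm, ← integral_const_mul]
  refine norm_integral_le_of_norm_le ((L1.integrable_coeFn _).norm.const_mul C) ?_
  filter_upwards [Lp.coeFn_sub (F n) G] with p hp
  rw [hp, Pi.sub_apply, ← sub_mul, norm_mul, mul_comm]
  gcongr
  exact hC p

namespace UnitaryGroup

variable {d : ℕ} {H : Type*} [NormedAddCommGroup H] [InnerProductSpace ℂ H] [CompleteSpace H]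
  (U : UnitaryGroup d H) {β : LinearMap.BilinForm ℝ (E d)}

lemma integral_norm_sub_le_of_fourierPairing_inner_eq (hβ : β.Nondegenerate) {Φ Φ' χ : H}
    {h h' : E d → ℂ} (hh : Integrable h) (hh' : Integrable h')
    (hΦ : ∀ f, fourierPairing β (fun x => ⟪Φ, U.toFun x χ⟫_ℂ) f = ∫ p, h p * f p)
    (hΦ' : ∀ f, fourierPairing β (fun x => ⟪Φ', U.toFun x χ⟫_ℂ) f = ∫ p, h' p * f p) :
    ∫ p, ‖h p - h' p‖ ≤ ‖pairingConst hβ‖ * ‖χ‖ * ‖Φ - Φ'‖ := by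
  refine integral_norm_le_of_forall_schwartz (hh.sub hh') fun f hfc hf => ?_
  have hint : ∀ {h : E d → ℂ}, Integrable h → Integrable fun p => h p * f p := fun hh =>
    hh.mul_bdd f.continuous.aestronglyMeasurable (ae_of_all _ hf)
  have hpair : ∫ p, (h p - h' p) * f p =
      pairingConst hβ * ⟪Φ - Φ', U.smear (frequencyEquiv hβ : E d →L[ℝ] E d) f χ⟫_ℂ := by
    simp only [sub_mul]
    rw [integral_sub (hint hh) (hint hh'), ← hΦ, ← hΦ', U.fourierPairing_inner hβ,
      U.fourierPairing_inner hβ, inner_sub_left, mul_sub]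
  have hsmear := U.norm_smear_apply_le (frequencyEquiv hβ : E d →L[ℝ] E d) hfc hf χ
  rw [one_mul] at hsmear
  rw [Pi.sub_def, hpair, norm_mul, mul_assoc, mul_comm ‖χ‖]
  gcongr
  exact (norm_inner_le_norm _ _).trans (by gcongr)

theorem isClosed_setOf_fourierInL1_inner (hβ : β.Nondegenerate) (χ : H) :
    IsClosed {Φ : H | FourierInL1 β fun x => ⟪Φ, U.toFun x χ⟫_ℂ} := by
  refine IsSeqClosed.isClosed fun Φs Φ hΦs hΦ => ?_
  choose h hh hpair using hΦs
  let F : ℕ → E d →₁[volume] ℂ := fun n => (hh n).toL1 (h n)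
  have hFpair : ∀ n (f : 𝓢(E d, ℂ)),
      ∫ p, F n p * f p = fourierPairing β (fun x => ⟪Φs n, U.toFun x χ⟫_ℂ) f := fun n f =>
    (integral_congr_ae ((hh n).coeFn_toL1.mul EventuallyEq.rfl)).trans (hpair n f).symm
  have hdist : ∀ m n, dist (F m) (F n) ≤ ‖pairingConst hβ‖ * ‖χ‖ * dist (Φs m) (Φs n) :=
    fun m n => by
      rw [dist_eq_norm, dist_eq_norm, ← Integrable.toL1_sub, L1.norm_of_fun_eq_integral_norm]
      exact U.integral_norm_sub_le_of_fourierPairing_inner_eq hβ (hh m) (hh n) (hpair m) (hpair n)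
  have hcauchy : CauchySeq F := by
    have hzero := (cauchySeq_iff_tendsto_dist_atTop_0.1 hΦ.cauchySeq).const_mul
      (‖pairingConst hβ‖ * ‖χ‖)
    rw [mul_zero] at hzero
    exact cauchySeq_iff_tendsto_dist_atTop_0.2
      (squeeze_zero (fun _ => dist_nonneg) (fun n => hdist n.1 n.2) hzero)
  obtain ⟨G, hG⟩ := cauchySeq_tendsto_of_complete hcauchy
  refine ⟨G, L1.integrable_coeFn G, fun f => tendsto_nhds_unique ?_
    (tendsto_integral_mul_of_tendsto_L1 hG f.continuous.aestronglyMeasurable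
      (SchwartzMap.norm_le_seminorm ℂ f))⟩
  simp only [hFpair, U.fourierPairing_inner hβ]
  exact (hΦ.inner tendsto_const_nhds).const_mul _

end UnitaryGroup

/-! ### Irreducibility of the GNS representation of a pure state -/

section States

variable {𝔄 : Type*} [CStarAlgebra 𝔄] {ω₀ φ ψ : StrongDual ℂ 𝔄}

lemma inv_smul_mem_states {r : ℝ} (hr : 0 < r) (hφ : ∀ A, 0 ≤ φ (star A * A))
    (hφr : φ 1 = r) : (r⁻¹ : ℂ) • φ ∈ states 𝔄 := by
  refine ⟨fun A => ?_, ?_⟩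
  · have hr' : (0 : ℂ) ≤ (r : ℂ)⁻¹ := by exact_mod_cast inv_nonneg.2 hr.le
    exact mul_nonneg hr' (hφ A)
  · rw [smul_apply, hφr, smul_eq_mul, inv_mul_cancel₀ (by exact_mod_cast hr.ne')]

lemma IsPureState.eq_smul_of_add_eq_smul (hω : IsPureState ω₀) {s t : ℝ} (hs : 0 < s) (ht : 0 < t)
    (hφ : ∀ A, 0 ≤ φ (star A * A)) (hφ₁ : φ 1 = s) (hψ : ∀ A, 0 ≤ ψ (star A * A)) (hψ₁ : ψ 1 = t)
    (hsum : φ + ψ = ((s + t : ℝ) : ℂ) • ω₀) : φ = (s : ℂ) • ω₀ := by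
  have hs₀ : (s : ℂ) ≠ 0 := by exact_mod_cast hs.ne'
  have ht₀ : (t : ℂ) ≠ 0 := by exact_mod_cast ht.ne'
  have hst₀ : ((s + t : ℝ) : ℂ) ≠ 0 := by exact_mod_cast (add_pos hs ht).ne'
  have hsegment : ω₀ ∈ openSegment ℝ ((s : ℂ)⁻¹ • φ) ((t : ℂ)⁻¹ • ψ) := by
    refine ⟨s / (s + t), t / (s + t), by positivity, by positivity, by field_simp, ?_⟩
    rw [← inv_smul_eq_iff₀ hst₀] at hsum
    ext A
    rw [← hsum]
    simp only [add_apply, smul_apply, Complex.real_smul, smul_eq_mul, Complex.ofReal_div]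
    field_simp
  have heq : (s : ℂ)⁻¹ • φ = ω₀ :=
    hω.2 (inv_smul_mem_states hs hφ hφ₁) (inv_smul_mem_states ht hψ hψ₁) hsegment
  exact (inv_smul_eq_iff₀ hs₀).1 heq

lemma IsPureState.eq_smul_of_le (hω : IsPureState ω₀) {c : ℝ} (hφ : ∀ A, 0 ≤ φ (star A * A))
    (hle : ∀ A, φ (star A * A) ≤ c * ω₀ (star A * A)) : φ = φ 1 • ω₀ := by
  have hω₁ : ω₀ 1 = 1 := hω.1.2
  obtain ⟨t, ht₀, ht⟩ : ∃ t : ℝ, 0 ≤ t ∧ φ 1 = t := by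
    have h := hφ 1
    rw [star_one, one_mul] at h
    exact ⟨(φ 1).re, (Complex.nonneg_iff.1 h).1, Complex.eq_re_of_ofReal_le h⟩
  have htc : t ≤ c := by
    have h := hle 1
    rw [star_one, one_mul, ht, hω₁, mul_one] at h
    exact_mod_cast h
  -- Adding `ω₀` to both parts of `c • ω₀ = φ + (c • ω₀ - φ)` makes their values at `1` positive.
  have heq : φ + ω₀ = ((t + 1 : ℝ) : ℂ) • ω₀ := by
    refine hω.eq_smul_of_add_eq_smul (ψ := ((c + 1 : ℝ) : ℂ) • ω₀ - φ) (t := c + 1 - t)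
      (by linarith) (by linarith) (fun A => add_nonneg (hφ A) (hω.1.1 A)) (by simp [ht, hω₁])
      (fun A => ?_) (by simp [ht, hω₁]) (by ext A; simp; ring)
    rw [sub_apply, smul_apply, sub_nonneg, smul_eq_mul, Complex.ofReal_add, add_mul]
    exact (hle A).trans (le_add_of_nonneg_right (by simpa using hω.1.1 A))
  rw [ht]
  ext A
  have hA := DFunLike.congr_fun heq A
  simp only [add_apply, smul_apply, smul_eq_mul, Complex.ofReal_add, Complex.ofReal_one] at hA ⊢
  linear_combination hA

end States

section PureState

variable {𝔄 : Type*} [CStarAlgebra 𝔄] {H : Type*} [NormedAddCommGroup H] [InnerProductSpace ℂ H]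
  [CompleteSpace H] {π : 𝔄 →⋆ₐ[ℂ] (H →L[ℂ] H)} {Ω : H} {ω₀ : StrongDual ℂ 𝔄}

@[simp] lemma vectorFunctional_apply (Ψ Φ : H) (A : 𝔄) :
    vectorFunctional π Ψ Φ A = ⟪Ψ, π A Φ⟫_ℂ := rfl

lemma inner_map_star (π : 𝔄 →⋆ₐ[ℂ] (H →L[ℂ] H)) (A : 𝔄) (Ψ Φ : H) :
    ⟪Ψ, π (star A) Φ⟫_ℂ = ⟪π A Ψ, Φ⟫_ℂ := by
  rw [map_star, ContinuousLinearMap.star_eq_adjoint, ContinuousLinearMap.adjoint_inner_right]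

lemma inner_map_star_left (π : 𝔄 →⋆ₐ[ℂ] (H →L[ℂ] H)) (A : 𝔄) (Ψ Φ : H) :
    ⟪π (star A) Ψ, Φ⟫_ℂ = ⟪Ψ, π A Φ⟫_ℂ := by
  rw [← inner_map_star, star_star]

lemma inner_map_star_mul (π : 𝔄 →⋆ₐ[ℂ] (H →L[ℂ] H)) (A B : 𝔄) (Ψ Φ : H) :
    ⟪Ψ, π (star A * B) Φ⟫_ℂ = ⟪π A Ψ, π B Φ⟫_ℂ := by
  rw [map_mul]
  exact inner_map_star π A Ψ (π B Φ)

/-- The map `A ↦ π(A)Φ`, whose range is the orbit of the vector `Φ` under the representation. -/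
def orbitMap (π : 𝔄 →⋆ₐ[ℂ] (H →L[ℂ] H)) (Φ : H) : 𝔄 →ₗ[ℂ] H where
  toFun A := π A Φ
  map_add' := by simp
  map_smul' := by simp

lemma orbitMap_apply (A : 𝔄) (Φ : H) : orbitMap π Φ A = π A Φ := rfl

lemma map_orbitMap (A B : 𝔄) (Φ : H) : π A (orbitMap π Φ B) = orbitMap π Φ (A * B) := by
  rw [orbitMap_apply, orbitMap_apply, map_mul, mul_apply_eq_comp]

lemma eq_zero_of_forall_inner_eq_zero {Φ Ψ : H} (hΦ : DenseRange (orbitMap π Φ))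
    (h : ∀ A, ⟪Ψ, π A Φ⟫_ℂ = 0) : Ψ = 0 :=
  Dense.eq_zero_of_inner_left (𝕜 := ℂ) hΦ (Set.forall_mem_range.2 h)

lemma IsGNSTriple.denseRange (hGNS : IsGNSTriple ω₀ π Ω) : DenseRange (orbitMap π Ω) :=
  hGNS.cyclic

lemma IsGNSTriple.inner_self (hGNS : IsGNSTriple ω₀ π Ω) (h1 : ω₀ 1 = 1) : ⟪Ω, Ω⟫_ℂ = 1 := by
  have := hGNS.inner_eq 1
  rwa [map_one, one_apply_eq_self, h1] at this

lemma IsGNSTriple.ne_zero (hGNS : IsGNSTriple ω₀ π Ω) (h1 : ω₀ 1 = 1) : Ω ≠ 0 := by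
  rintro rfl
  simpa using hGNS.inner_self h1

lemma IsPureState.exists_eq_smul_of_isPositive (hω : IsPureState ω₀) (hGNS : IsGNSTriple ω₀ π Ω)
    {P : H →L[ℂ] H} (hP : P.IsPositive) (hcomm : ∀ A Ψ, P (π A Ψ) = π A (P Ψ)) :
    ∃ t : ℂ, ∀ Ψ, P Ψ = t • Ψ := by
  have hφ : ∀ A, vectorFunctional π Ω (P Ω) (star A * A) = ⟪π A Ω, P (π A Ω)⟫_ℂ := fun A => by
    rw [vectorFunctional_apply, inner_map_star_mul, hcomm]
  have hnonneg : ∀ A, 0 ≤ vectorFunctional π Ω (P Ω) (star A * A) := fun A => by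
    rw [hφ]
    exact hP.inner_nonneg_right _
  have hle : ∀ A, vectorFunctional π Ω (P Ω) (star A * A) ≤ ‖P‖ * ω₀ (star A * A) := fun A => by
    rw [Complex.eq_re_of_ofReal_le (hnonneg A), hφ, ← hGNS.inner_eq, inner_map_star_mul,
      inner_self_eq_norm_sq_to_K]
    have h : (⟪π A Ω, P (π A Ω)⟫_ℂ).re ≤ ‖P‖ * ‖π A Ω‖ ^ 2 :=
      calc _ ≤ ‖π A Ω‖ * ‖P (π A Ω)‖ := re_inner_le_norm (𝕜 := ℂ) _ _
        _ ≤ ‖π A Ω‖ * (‖P‖ * ‖π A Ω‖) := by gcongr; exact P.le_opNorm _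
        _ = _ := by ring
    simp only [RCLike.ofReal_eq_complex_ofReal]
    exact_mod_cast h
  obtain ⟨t, ht⟩ : ∃ t : ℂ, vectorFunctional π Ω (P Ω) = t • ω₀ :=
    ⟨_, hω.eq_smul_of_le hnonneg hle⟩
  have hPΩ : P Ω = t • Ω := by
    refine sub_eq_zero.1 (Dense.eq_zero_of_inner_right (𝕜 := ℂ) hGNS.denseRange ?_)
    rintro _ ⟨A, rfl⟩
    have h := DFunLike.congr_fun ht (star A)
    rw [vectorFunctional_apply, inner_map_star, smul_apply, ← hGNS.inner_eq, inner_map_star,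
      smul_eq_mul] at h
    rw [orbitMap_apply, inner_sub_right, inner_smul_right, h, sub_self]
  refine ⟨t, congrFun (hGNS.denseRange.equalizer P.continuous (continuous_const_smul t) ?_)⟩
  funext A
  simp only [Function.comp_apply, orbitMap_apply, hcomm, hPΩ, map_smul]

lemma IsPureState.exists_eq_smul_of_isSelfAdjoint (hω : IsPureState ω₀)
    (hGNS : IsGNSTriple ω₀ π Ω) {S : H →L[ℂ] H} (hS : IsSelfAdjoint S)
    (hcomm : ∀ A Ψ, S (π A Ψ) = π A (S Ψ)) : ∃ t : ℂ, ∀ Ψ, S Ψ = t • Ψ := by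
  have hpos : (S + (‖S‖ : ℂ) • 1).IsPositive := by
    refine (ContinuousLinearMap.nonneg_iff_isPositive _).1 ?_
    have h := hS.neg_algebraMap_norm_le_self
    rw [neg_le_iff_add_nonneg] at h
    convert h using 2
    rw [Algebra.algebraMap_eq_smul_one, Complex.coe_smul]
  obtain ⟨t, ht⟩ := hω.exists_eq_smul_of_isPositive hGNS hpos fun A Ψ => by simp [hcomm]
  refine ⟨t - ‖S‖, fun Ψ => ?_⟩
  rw [sub_smul, ← ht]
  simp

lemma IsPureState.exists_eq_smul (hω : IsPureState ω₀) (hGNS : IsGNSTriple ω₀ π Ω)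
    {S : H →L[ℂ] H} (hcomm : ∀ A Ψ, S (π A Ψ) = π A (S Ψ)) : ∃ t : ℂ, ∀ Ψ, S Ψ = t • Ψ := by
  have hstar : ∀ A Ψ, (star S) (π A Ψ) = π A ((star S) Ψ) := fun A Ψ => by
    refine ext_inner_left ℂ fun Φ => ?_
    rw [ContinuousLinearMap.star_eq_adjoint, ContinuousLinearMap.adjoint_inner_right,
      ← inner_map_star_left, ← hcomm, ← inner_map_star_left,
      ContinuousLinearMap.adjoint_inner_right]
  obtain ⟨a, ha⟩ := hω.exists_eq_smul_of_isSelfAdjoint hGNS (S := realPart S)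
    (realPart S).2 fun A Ψ => by simp [realPart_apply_coe, hcomm, hstar]
  obtain ⟨b, hb⟩ := hω.exists_eq_smul_of_isSelfAdjoint hGNS (S := imaginaryPart S)
    (imaginaryPart S).2 fun A Ψ => by simp [imaginaryPart_apply_coe, hcomm, hstar]
  refine ⟨a + Complex.I * b, fun Ψ => ?_⟩
  rw [add_smul, mul_smul, ← ha, ← hb]
  exact (DFunLike.congr_fun (realPart_add_I_smul_imaginaryPart S) Ψ).symm

lemma map_mem_topologicalClosure_range_orbitMap (A : 𝔄) {Φ Ψ : H}
    (hΨ : Ψ ∈ (LinearMap.range (orbitMap π Φ)).topologicalClosure) :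
    π A Ψ ∈ (LinearMap.range (orbitMap π Φ)).topologicalClosure := by
  have hmaps : Set.MapsTo (π A) (LinearMap.range (orbitMap π Φ))
      (LinearMap.range (orbitMap π Φ)) := by
    rintro _ ⟨B, rfl⟩
    exact ⟨A * B, (map_orbitMap A B Φ).symm⟩
  exact hmaps.closure (π A).continuous hΨ

lemma IsPureState.denseRange_orbitMap (hω : IsPureState ω₀) (hGNS : IsGNSTriple ω₀ π Ω) {Φ : H}
    (hΦ : Φ ≠ 0) : DenseRange (orbitMap π Φ) := by
  set M : Submodule ℂ H := (LinearMap.range (orbitMap π Φ)).topologicalClosure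
  have : CompleteSpace M := (Submodule.isClosed_topologicalClosure _).completeSpace_coe
  have hinv : ∀ A, ∀ Ψ ∈ M, π A Ψ ∈ M := fun A Ψ => map_mem_topologicalClosure_range_orbitMap A
  have hcomm : ∀ A Ψ, M.starProjection (π A Ψ) = π A (M.starProjection Ψ) := fun A Ψ => by
    refine Submodule.eq_starProjection_of_mem_of_inner_eq_zero (hinv A _ (by simp))
      fun w hw => ?_
    rw [← map_sub, ← inner_map_star]
    exact Submodule.starProjection_inner_eq_zero Ψ _ (hinv _ _ hw)
  obtain ⟨t, ht⟩ := hω.exists_eq_smul hGNS hcomm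
  have hΦM : Φ ∈ M := Submodule.le_topologicalClosure _ ⟨1, by simp [orbitMap_apply]⟩
  have ht1 : t = 1 := by
    refine smul_left_injective ℂ hΦ ?_
    simp only [one_smul, ← ht]
    exact Submodule.starProjection_eq_self_iff.2 hΦM
  intro Ψ
  have hΨ : Ψ ∈ M := by rw [← Submodule.starProjection_eq_self_iff, ht, ht1, one_smul]
  exact hΨ

lemma IsPureState.exists_eq_smul_of_norm_map_le (hω : IsPureState ω₀) (hGNS : IsGNSTriple ω₀ π Ω)
    {Ψ Φ : H} (hΦ : Φ ≠ 0) {C : ℝ} (hle : ∀ A, ‖π A Ψ‖ ≤ C * ‖π A Φ‖) :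
    ∃ t : ℂ, Ψ = t • Φ := by
  have hdense := hω.denseRange_orbitMap hGNS hΦ
  -- The assumption makes `π(A)Φ ↦ π(A)Ψ` a well-defined bounded operator in the commutant.
  set S : H →L[ℂ] H := (orbitMap π Ψ).extendOfNorm (orbitMap π Φ)
  have hS : ∀ A, S (orbitMap π Φ A) = orbitMap π Ψ A :=
    LinearMap.extendOfNorm_eq hdense ⟨C, hle⟩
  have hcomm : ∀ A Ξ, S (π A Ξ) = π A (S Ξ) := fun A => by
    refine congrFun (hdense.equalizer (by fun_prop) (by fun_prop) ?_)
    funext B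
    simp only [Function.comp_apply, map_orbitMap, hS]
  obtain ⟨t, ht⟩ := hω.exists_eq_smul hGNS hcomm
  refine ⟨t, ?_⟩
  simpa [orbitMap_apply, ht] using (hS 1).symm

lemma IsPureState.exists_inner_ne_zero (hω : IsPureState ω₀) (hGNS : IsGNSTriple ω₀ π Ω) {Ψ Φ : H}
    (hΨ : Ψ ≠ 0) (hΦ : Φ ≠ 0) (hΨΩ : ⟪Ω, Ψ⟫_ℂ = 0) (hΦΩ : ⟪Ω, Φ⟫_ℂ = 0) :
    ∃ A, ω₀ A = 0 ∧ ⟪Ψ, π A Φ⟫_ℂ ≠ 0 := by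
  by_contra! hvanish
  have hω1 : ω₀ 1 = 1 := hω.1.2
  have hprop : ∀ A, ⟪Ψ, π A Φ⟫_ℂ = ω₀ A * ⟪Ψ, Φ⟫_ℂ := fun A => by
    have h := hvanish (A - ω₀ A • 1) (by simp [hω1])
    rwa [map_sub, map_smul, map_one, sub_apply, smul_apply, one_apply_eq_self, inner_sub_right,
      inner_smul_right, sub_eq_zero] at h
  have hne : ⟪Ψ, Φ⟫_ℂ ≠ 0 := fun h0 =>
    hΨ (eq_zero_of_forall_inner_eq_zero (hω.denseRange_orbitMap hGNS hΦ) fun A => by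
      rw [hprop, h0, mul_zero])
  set Φ' : H := (⟪Ψ, Φ⟫_ℂ)⁻¹ • Φ with hΦ'
  have hinner : ∀ A, RCLike.re ⟪π A Ψ, π A Φ'⟫_ℂ = ‖π A Ω‖ ^ 2 := fun A => by
    rw [hΦ', map_smul, inner_smul_right, ← inner_map_star_mul, hprop, ← hGNS.inner_eq,
      inner_map_star_mul, mul_comm, mul_assoc, mul_inv_cancel₀ hne, mul_one,
      inner_self_eq_norm_sq]
  have hle : ∀ A, ‖π A Ω‖ ≤ 1 * ‖π A (Ψ + Φ')‖ := fun A => by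
    have hadd := norm_add_sq (𝕜 := ℂ) (π A Ψ) (π A Φ')
    have hsub := norm_sub_sq (𝕜 := ℂ) (π A Ψ) (π A Φ')
    rw [hinner] at hadd hsub
    rw [one_mul, map_add]
    refine (sq_le_sq₀ (norm_nonneg _) (norm_nonneg _)).1 ?_
    nlinarith [sq_nonneg ‖π A Ψ - π A Φ'‖, sq_nonneg ‖π A Ω‖]
  have hsum : Ψ + Φ' ≠ 0 := fun h => hGNS.ne_zero hω1 <| by simpa [h] using hle 1
  obtain ⟨t, ht⟩ := hω.exists_eq_smul_of_norm_map_le hGNS hsum hle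
  have horth : ⟪Ω, Ω⟫_ℂ = 0 := by
    nth_rewrite 2 [ht]
    simp only [hΦ', inner_smul_right, inner_add_right, hΨΩ, hΦΩ, mul_zero, add_zero]
  exact hGNS.ne_zero hω1 (inner_self_eq_zero.1 horth)

end PureState

/-! ### Means over cuboids -/

section Means

variable {d : ℕ}

lemma norm_cuboidMean_le (L : Fin d → ℝ) {g : E d → ℂ} {C : ℝ} (hC : ∀ x, ‖g x‖ ≤ C) :
    ‖cuboidMean L g‖ ≤ C := by
  have hC₀ : 0 ≤ C := (norm_nonneg _).trans (hC 0)
  have hint : ‖∫ x in cuboid L, g x‖ ≤ C * volume.real (cuboid L) :=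
    norm_setIntegral_le_of_norm_le_const (isCompact_cuboid L).measure_lt_top fun x _ => hC x
  rw [cuboidMean, norm_mul, Complex.norm_real, Real.norm_of_nonneg (by positivity)]
  calc _ ≤ (volume.real (cuboid L))⁻¹ * (C * volume.real (cuboid L)) := by gcongr
    _ = C * ((volume.real (cuboid L))⁻¹ * volume.real (cuboid L)) := by ring
    _ ≤ C := mul_le_of_le_one_right hC₀ inv_mul_le_one

lemma eventually_cuboidMean_const (K : CuboidFamily d) (c : ℂ) :
    ∀ᶠ L in K.filter, cuboidMean L (fun _ => c) = c := by
  have hlength : ∀ᶠ L in K.filter, ∀ i, 1 ≤ L i :=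
    eventually_all.2 fun i => (K.tendsto_atTop i).eventually_ge_atTop _
  filter_upwards [hlength] with L hL
  have hpos : 0 < volume.real (cuboid L) := by
    rw [volume_cuboid fun i => zero_le_one.trans (hL i)]
    exact Finset.prod_pos fun i _ => by linarith [hL i]
  rw [cuboidMean, setIntegral_const, Complex.real_smul, ← mul_assoc, ← Complex.ofReal_mul,
    inv_mul_cancel₀ hpos.ne', Complex.ofReal_one, one_mul]

lemma eq_zero_of_tendsto_cuboidMean_const (K : CuboidFamily d) {c : ℂ}
    (h : Tendsto (fun L => cuboidMean L fun _ => c) K.filter (𝓝 0)) : c = 0 := by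
  have := K.neBot
  exact tendsto_nhds_unique
    (tendsto_const_nhds.congr' ((eventually_cuboidMean_const K c).mono fun L hL => hL.symm)) h

end Means

namespace IsometricFlow

variable {d : ℕ} {X : Type*} [NormedAddCommGroup X] [NormedSpace ℂ X] (F : IsometricFlow d X)
  (β : LinearMap.BilinForm ℝ (E d)) (K : CuboidFamily d)

lemma isBoundedContinuous {φ : StrongDual ℂ X} (hφ : φ ∈ F.fn) (A : X) :
    IsBoundedContinuous fun x => φ (F.act x A) := by
  refine ⟨F.continuous_fn φ hφ A, ‖φ‖ * ‖A‖, fun x => ?_⟩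
  simpa using φ.le_opNorm (F.act x A)

lemma norm_cuboidMean_exp_mul_le (L : Fin d → ℝ) (q : E d) (φ : StrongDual ℂ X) (A : X) :
    ‖cuboidMean L fun x => Complex.exp (-(Complex.I * (β q x : ℂ))) * φ (F.act x A)‖ ≤
      ‖φ‖ * ‖A‖ := by
  refine norm_cuboidMean_le L fun x => ?_
  have hphase : ‖Complex.exp (-(Complex.I * (β q x : ℂ)))‖ = 1 := by simp [Complex.norm_exp]
  rw [norm_mul, hphase, one_mul]
  simpa using φ.le_opNorm (F.act x A)

lemma isClosed_continuousSubspace : IsClosed (F.continuousSubspace β K : Set X) := by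
  refine isClosed_of_closure_subset fun A hA q φ hφ => ?_
  let mean (L : Fin d → ℝ) (B : X) : ℂ :=
    cuboidMean L fun x => Complex.exp (-(Complex.I * (β q x : ℂ))) * φ (F.act x B)
  have hmean_add : ∀ L B C, mean L (B + C) = mean L B + mean L C := fun L B C => by
    simp only [mean, map_add, mul_add]
    exact cuboidMean_add L (F.continuous_integrand β q hφ _) (F.continuous_integrand β q hφ _)
  rw [Metric.tendsto_nhds]
  intro ε hε
  obtain ⟨B, hB, hAB⟩ := Metric.mem_closure_iff.1 hA (ε / (2 * (‖φ‖ + 1))) (by positivity)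
  rw [dist_eq_norm, lt_div_iff₀ (by positivity)] at hAB
  filter_upwards [Metric.tendsto_nhds.1 (hB q φ hφ) (ε / 2) (by positivity)] with L hL
  rw [dist_zero_right] at hL ⊢
  calc ‖mean L A‖ = ‖mean L (A - B) + mean L B‖ := by rw [← hmean_add, sub_add_cancel]
    _ ≤ ‖φ‖ * ‖A - B‖ + ‖mean L B‖ :=
      (norm_add_le _ _).trans (by gcongr; exact F.norm_cuboidMean_exp_mul_le β L q φ (A - B))
    _ < ‖φ‖ * ‖A - B‖ + ε / 2 := by gcongr
    _ ≤ ε := by nlinarith [norm_nonneg (A - B)]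

end IsometricFlow

/-! ### The implementing unitary group -/

section Extension

lemma exists_linearIsometry_of_denseRange {𝕜 X G H : Type*} [NormedField 𝕜] [AddCommGroup X]
    [Module 𝕜 X] [NormedAddCommGroup G] [NormedSpace 𝕜 G] [NormedAddCommGroup H]
    [NormedSpace 𝕜 H] [CompleteSpace H] {e : X →ₗ[𝕜] G} {f : X →ₗ[𝕜] H} (he : DenseRange e)
    (hnorm : ∀ A, ‖f A‖ = ‖e A‖) : ∃ W : G →ₗᵢ[𝕜] H, ∀ A, W (e A) = f A := by
  have hW : ∀ A, f.extendOfNorm e (e A) = f A :=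
    LinearMap.extendOfNorm_eq he ⟨1, fun A => by rw [one_mul, hnorm]⟩
  refine ⟨⟨(f.extendOfNorm e).toLinearMap, congrFun (he.equalizer ?_ continuous_norm ?_)⟩, hW⟩
  · exact (f.extendOfNorm e).continuous.norm
  · funext A
    exact (congrArg norm (hW A)).trans (hnorm A)

lemma exists_unitaryGroup_apply_eq {d : ℕ} {X H : Type*} [AddCommGroup X] [Module ℂ X]
    [NormedAddCommGroup H] [InnerProductSpace ℂ H] [CompleteSpace H] {e : X →ₗ[ℂ] H}
    (he : DenseRange e) {τ : E d → X →ₗ[ℂ] X} (hzero : ∀ A, τ 0 A = A)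
    (hadd : ∀ x y A, τ (x + y) A = τ x (τ y A)) (hnorm : ∀ x A, ‖e (τ x A)‖ = ‖e A‖)
    (hcont : ∀ A, Continuous fun x => e (τ x A)) :
    ∃ U : UnitaryGroup d H, ∀ x A, U.toFun x (e A) = e (τ x A) := by
  choose W hW using fun x =>
    exists_linearIsometry_of_denseRange (f := e ∘ₗ τ x) he (hnorm x)
  simp only [LinearMap.comp_apply] at hW
  have hWzero : ∀ Ψ, W 0 Ψ = Ψ := by
    refine congrFun (he.equalizer (W 0).continuous continuous_id ?_)
    funext A
    simp [hW, hzero]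
  have hWadd : ∀ x y Ψ, W (x + y) Ψ = W x (W y Ψ) := fun x y => by
    refine congrFun (he.equalizer (W _).continuous ((W x).continuous.comp (W y).continuous) ?_)
    funext A
    simp [hW, hadd]
  have hsurj : ∀ x, Function.Surjective (W x) := fun x Ψ =>
    ⟨W (-x) Ψ, by rw [← hWadd, add_neg_cancel, hWzero]⟩
  have hWcont : ∀ Ψ, Continuous fun x => W x Ψ := fun Ψ => by
    refine continuous_of_uniform_approx_of_continuous fun u hu => ?_
    obtain ⟨ε, hε, hεu⟩ := Metric.mem_uniformity_dist.1 hu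
    obtain ⟨_, ⟨A, rfl⟩, hA⟩ := Metric.mem_closure_iff.1 (he Ψ) ε hε
    refine ⟨fun x => e (τ x A), hcont A, fun x => hεu ?_⟩
    change dist (W x Ψ) (e (τ x A)) < ε
    rwa [← hW, (W x).dist_map]
  exact ⟨⟨fun x => LinearIsometryEquiv.ofSurjective (W x) (hsurj x), hWzero, hWadd, hWcont⟩, hW⟩

end Extension

section GNS

variable {d : ℕ} {𝔄 : Type*} [CStarAlgebra 𝔄] {H : Type*} [NormedAddCommGroup H]
  [InnerProductSpace ℂ H] [CompleteSpace H] {β : LinearMap.BilinForm ℝ (E d)}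
  {K : CuboidFamily d} {α : AutomorphismGroup d 𝔄} {π : 𝔄 →⋆ₐ[ℂ] (H →L[ℂ] H)} {Ω : H}
  {ω₀ : StrongDual ℂ 𝔄} {U : UnitaryGroup d H}

lemma AutomorphismGroup.flow_act (α : AutomorphismGroup d 𝔄) (P : Submodule ℂ (StrongDual ℂ 𝔄))
    (x : E d) (A : 𝔄) : (α.flow P).act x A = α.toFun x A := rfl

lemma UnitaryGroup.flow_act {H : Type*} [NormedAddCommGroup H] [InnerProductSpace ℂ H]
    (U : UnitaryGroup d H) (x : E d) (Ψ : H) : U.flow.act x Ψ = U.toFun x Ψ := rfl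

lemma vectorFunctional_mem_predual (Ψ Φ : H) : vectorFunctional π Ψ Φ ∈ predual π :=
  Submodule.le_topologicalClosure _ (Submodule.subset_span ⟨(Ψ, Φ), rfl⟩)

lemma IsGNSTriple.vectorFunctional_eq (hGNS : IsGNSTriple ω₀ π Ω) :
    vectorFunctional π Ω Ω = ω₀ := by
  ext A
  exact hGNS.inner_eq A

lemma IsGNSTriple.mem_predual (hGNS : IsGNSTriple ω₀ π Ω) : ω₀ ∈ predual π := by
  rw [← hGNS.vectorFunctional_eq]
  exact vectorFunctional_mem_predual Ω Ω

lemma apply_toFun_eq_of_ker_le (hGNS : IsGNSTriple ω₀ π Ω) (h1 : ω₀ 1 = 1)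
    (hker : ∀ A, ω₀ A = 0 → A ∈ (α.flow (predual π)).continuousSubspace β K) (x : E d) (A : 𝔄) :
    ω₀ (α.toFun x A) = ω₀ A := by
  have hmem : ∀ B : 𝔄, B - ω₀ B • 1 ∈ (α.flow (predual π)).continuousSubspace β K := fun B =>
    hker _ (by simp [h1])
  have hdiff : (ω₀ (α.toFun x A) - ω₀ A) • (1 : 𝔄) ∈
      (α.flow (predual π)).continuousSubspace β K := by
    convert Submodule.sub_mem _ ((α.flow (predual π)).act_mem_continuousSubspace β K x (hmem A))
      (hmem (α.toFun x A)) using 1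
    rw [AutomorphismGroup.flow_act, map_sub, map_smul, map_one]
    module
  have hmean := hdiff 0 ω₀ hGNS.mem_predual
  refine sub_eq_zero.1 (eq_zero_of_tendsto_cuboidMean_const K (hmean.congr fun L => ?_))
  congr 1
  funext y
  simp [AutomorphismGroup.flow_act, h1]

lemma mem_continuousSubspace_iff_apply_eq_zero (hGNS : IsGNSTriple ω₀ π Ω) (h1 : ω₀ 1 = 1)
    (hker : ∀ A, ω₀ A = 0 → A ∈ (α.flow (predual π)).continuousSubspace β K) (A : 𝔄) :
    A ∈ (α.flow (predual π)).continuousSubspace β K ↔ ω₀ A = 0 := by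
  refine ⟨fun hA => ?_, hker A⟩
  refine eq_zero_of_tendsto_cuboidMean_const K ((hA 0 ω₀ hGNS.mem_predual).congr fun L => ?_)
  congr 1
  funext y
  simp [AutomorphismGroup.flow_act, apply_toFun_eq_of_ker_le hGNS h1 hker]

lemma IsGNSTriple.norm_map_sq (hGNS : IsGNSTriple ω₀ π Ω) (A : 𝔄) :
    (‖π A Ω‖ : ℂ) ^ 2 = ω₀ (star A * A) := by
  rw [← hGNS.inner_eq, inner_map_star_mul, inner_self_eq_norm_sq_to_K]
  rfl

lemma continuous_representation (π : 𝔄 →⋆ₐ[ℂ] (H →L[ℂ] H)) : Continuous π :=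
  AddMonoidHomClass.continuous_of_bound π 1 fun A => by
    simpa using NonUnitalStarAlgHom.norm_apply_le π A

lemma Implements.of_apply_cyclic (hΩ : DenseRange (orbitMap π Ω))
    (hU : ∀ x A, U.toFun x (π A Ω) = π (α.toFun x A) Ω) : Implements α π Ω U where
  invariant x := by simpa using hU x 1
  covariant x A := by
    refine congrFun (hΩ.equalizer (by fun_prop) (by fun_prop) ?_)
    funext B
    have hsymm : (U.toFun x).symm (π B Ω) = π (α.toFun (-x) B) Ω := by rw [U.symm_apply, hU]
    have hmul : ∀ B C : 𝔄, π B (π C Ω) = π (B * C) Ω := fun B C => by rw [map_mul]; rfl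
    simp only [Function.comp_apply, orbitMap_apply, hsymm]
    rw [hmul, hmul, hU, map_mul (α.toFun x), ← α.map_add, add_neg_cancel, α.map_zero]

lemma exists_implements (hGNS : IsGNSTriple ω₀ π Ω)
    (hinv : ∀ x A, ω₀ (α.toFun x A) = ω₀ A) : ∃ U : UnitaryGroup d H, Implements α π Ω U := by
  have hnorm : ∀ x A, ‖π (α.toFun x A) Ω‖ = ‖π A Ω‖ := fun x A => by
    refine (pow_left_inj₀ (norm_nonneg _) (norm_nonneg _) two_ne_zero).1 ?_
    have h := hGNS.norm_map_sq (α.toFun x A)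
    rw [← map_star, ← map_mul, hinv, ← hGNS.norm_map_sq] at h
    exact_mod_cast h
  have hcont : ∀ A, Continuous fun x => π (α.toFun x A) Ω := fun A =>
    (ContinuousLinearMap.apply ℂ H Ω).continuous.comp
      ((continuous_representation π).comp (α.continuous_apply A))
  obtain ⟨U, hU⟩ := exists_unitaryGroup_apply_eq
    (τ := fun x => ((α.isometry x).toLinearEquiv : 𝔄 →ₗ[ℂ] 𝔄))
    hGNS.denseRange α.map_zero α.map_add hnorm hcont
  exact ⟨U, .of_apply_cyclic hGNS.denseRange hU⟩

lemma Implements.apply_cyclic (hU : Implements α π Ω U) (x : E d) (A : 𝔄) :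
    U.toFun x (π A Ω) = π (α.toFun x A) Ω := by
  have hsymm : (U.toFun x).symm Ω = Ω := by
    rw [LinearIsometryEquiv.symm_apply_eq, hU.invariant]
  rw [hU.covariant, hsymm]

lemma Implements.unique (hΩ : DenseRange (orbitMap π Ω)) (hU : Implements α π Ω U)
    {V : UnitaryGroup d H} (hV : Implements α π Ω V) : V = U := by
  have h : V.toFun = U.toFun := by
    funext x
    refine LinearIsometryEquiv.ext (congrFun
      (hΩ.equalizer (V.toFun x).continuous (U.toFun x).continuous ?_))
    funext A
    exact (hV.apply_cyclic x A).trans (hU.apply_cyclic x A).symm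
  cases V
  cases U
  cases h
  rfl

lemma Implements.vectorFunctional_toFun (hU : Implements α π Ω U) (Ψ Φ : H) (x : E d) (A : 𝔄) :
    vectorFunctional π Ψ Φ (α.toFun x A) = ⟪Ψ, U.toFun x (π A (U.toFun (-x) Φ))⟫_ℂ := by
  rw [vectorFunctional_apply, hU.covariant, U.symm_apply]

lemma Implements.inner_toFun (hU : Implements α π Ω U) (x : E d) (Ψ : H) :
    ⟪Ω, U.toFun x Ψ⟫_ℂ = ⟪Ω, Ψ⟫_ℂ := by
  conv_lhs => rw [← hU.invariant x]
  exact (U.toFun x).inner_map_map _ _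

lemma IsGNSTriple.mem_closure_of_inner_eq_zero (hGNS : IsGNSTriple ω₀ π Ω) (h1 : ω₀ 1 = 1) {Ψ : H}
    (hΨ : ⟪Ω, Ψ⟫_ℂ = 0) : Ψ ∈ closure ((fun A => π A Ω) '' {A | ω₀ A = 0}) := by
  let proj (Φ : H) : H := Φ - ⟪Ω, Φ⟫_ℂ • Ω
  have hproj : Continuous proj := by fun_prop
  have hmaps : Set.MapsTo proj (Set.range fun A => π A Ω)
      ((fun A => π A Ω) '' {A | ω₀ A = 0}) := by
    rintro _ ⟨B, rfl⟩
    exact ⟨B - ω₀ B • 1, by simp [h1], by simp [proj, hGNS.inner_eq]⟩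
  have hΨproj : proj Ψ = Ψ := by simp [proj, hΨ]
  rw [← hΨproj]
  exact map_mem_closure hproj (hGNS.cyclic Ψ) hmaps

lemma mem_continuousSubspace_iff_inner_eq_zero (hGNS : IsGNSTriple ω₀ π Ω) (h1 : ω₀ 1 = 1)
    (hker : ∀ A, ω₀ A = 0 → A ∈ (α.flow (predual π)).continuousSubspace β K)
    (hU : Implements α π Ω U) (Ψ : H) :
    Ψ ∈ U.flow.continuousSubspace β K ↔ ⟪Ω, Ψ⟫_ℂ = 0 := by
  constructor
  · intro hΨ
    have hmean := hΨ 0 (InnerProductSpace.toDual ℂ H Ω) trivial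
    refine eq_zero_of_tendsto_cuboidMean_const K (hmean.congr fun L => ?_)
    congr 1
    funext y
    simp [UnitaryGroup.flow_act, hU.inner_toFun]
  · intro hΨ
    refine closure_minimal ?_ (U.flow.isClosed_continuousSubspace β K)
      (hGNS.mem_closure_of_inner_eq_zero h1 hΨ)
    rintro _ ⟨A, hA, rfl⟩ q φ -
    obtain ⟨Φ, rfl⟩ := (InnerProductSpace.toDual ℂ H).surjective φ
    refine (hker A hA q _ (vectorFunctional_mem_predual Φ Ω)).congr fun L => ?_
    simp only [UnitaryGroup.flow_act, hU.apply_cyclic, InnerProductSpace.toDual_apply_apply,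
      AutomorphismGroup.flow_act, vectorFunctional_apply]

end GNS

/-! ### Points outside of the spectra -/

namespace IsometricFlow

variable {d : ℕ} {X : Type*} [NormedAddCommGroup X] [NormedSpace ℂ X] (F : IsometricFlow d X)
  {β : LinearMap.BilinForm ℝ (E d)} {K : CuboidFamily d}

lemma notMem_spectrumOn_iff (hβ : β.Nondegenerate) (S : Submodule ℂ X) (p : E d) :
    p ∉ F.spectrumOn β S ↔ ∃ r > 0, ∀ A ∈ S, ∀ φ ∈ F.fn,
      Distribution.IsVanishingOn (fourierPairing β fun x => φ (F.act x A)) (Metric.ball p r) := by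
  have h := notMem_closure_iUnion_fourierSupport_iff hβ
    (G := Set.image2 (fun A (φ : StrongDual ℂ X) x => φ (F.act x A)) S F.fn)
    (Set.forall_mem_image2.2 fun A _ φ hφ => F.isBoundedContinuous hφ A) p
  simp only [Set.biUnion_image2, Set.forall_mem_image2] at h
  exact h

lemma isBoundedContinuous_scClass (hF : ∀ A, Continuous fun x => F.act x A)
    (G : Submodule ℂ (StrongDual ℂ X)) (φ : StrongDual ℂ (F.ScSpace β K G))
    (A : F.continuousSubspace β K) : IsBoundedContinuous fun x => φ (F.scClass β K G A x) := by
  let ψ : StrongDual ℂ (F.continuousSubspace β K) := φ.comp (Submodule.mkQL _)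
  refine ⟨ψ.continuous.comp ((hF A).subtype_mk _), ‖ψ‖ * ‖A‖, fun x => ?_⟩
  refine (ψ.le_opNorm ⟨F.act x A, F.act_mem_continuousSubspace β K x A.2⟩).trans_eq ?_
  rw [Submodule.coe_norm, LinearIsometry.norm_map, Submodule.coe_norm]

lemma notMem_scSpectrum_iff (hβ : β.Nondegenerate) (hF : ∀ A, Continuous fun x => F.act x A)
    (G : Submodule ℂ (StrongDual ℂ X)) (p : E d) :
    p ∉ F.scSpectrum β K G ↔ ∃ r > 0, ∀ A (φ : StrongDual ℂ (F.ScSpace β K G)),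
      Distribution.IsVanishingOn (fourierPairing β fun x => φ (F.scClass β K G A x))
        (Metric.ball p r) := by
  have h := notMem_closure_iUnion_fourierSupport_iff hβ
    (G := Set.image2 (fun A (φ : StrongDual ℂ (F.ScSpace β K G)) x => φ (F.scClass β K G A x))
      Set.univ Set.univ)
    (Set.forall_mem_image2.2 fun A _ φ _ => F.isBoundedContinuous_scClass hF G φ A) p
  simp only [Set.biUnion_image2, Set.forall_mem_image2, Set.mem_univ, forall_const,
    Set.iUnion_true] at h
  exact h

lemma acSubspace_le_continuousSubspace (S : Submodule ℂ X) (G : Submodule ℂ (StrongDual ℂ X)) :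
    F.acSubspace β K S G ≤ F.continuousSubspace β K :=
  Submodule.topologicalClosure_minimal _ (Submodule.span_le.2 fun _ hA => hA.1.2)
    (F.isClosed_continuousSubspace β K)

lemma mem_acSubspace {S : Submodule ℂ X} {G : Submodule ℂ (StrongDual ℂ X)} {A : X}
    (hS : A ∈ S) (hA : A ∈ F.continuousSubspace β K)
    (hL : ∀ φ ∈ G, FourierInL1 β fun x => φ (F.act x A)) : A ∈ F.acSubspace β K S G :=
  Submodule.le_topologicalClosure _ (Submodule.subset_span ⟨⟨hS, hA⟩, hL⟩)

end IsometricFlow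

namespace UnitaryGroup

variable {d : ℕ} {H : Type*} [NormedAddCommGroup H] [InnerProductSpace ℂ H]
  (U : UnitaryGroup d H) {β : LinearMap.BilinForm ℝ (E d)} {K : CuboidFamily d}

lemma isVanishingOn_inner_comm {Φ Ψ : H} {p : E d} {r : ℝ}
    (h : Distribution.IsVanishingOn (fourierPairing β fun x => ⟪Φ, U.toFun x Ψ⟫_ℂ)
      (Metric.ball p r)) :
    Distribution.IsVanishingOn (fourierPairing β fun x => ⟪Ψ, U.toFun x Φ⟫_ℂ)
      (Metric.ball p r) := by
  rw [← neg_neg p] at h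
  convert isVanishingOn_fourierPairing_neg (isVanishingOn_fourierPairing_conj h) using 3 with x
  rw [inner_conj_symm, U.inner_toFun_left, neg_neg]

variable [CompleteSpace H]

lemma isVanishingOn_inner_iff (hβ : β.Nondegenerate) {Φ Ψ : H} {s : Set (E d)} :
    Distribution.IsVanishingOn (fourierPairing β fun x => ⟪Φ, U.toFun x Ψ⟫_ℂ) s ↔
      ∀ f : 𝓢(E d, ℂ), tsupport f ⊆ s →
        ⟪Φ, U.smear (frequencyEquiv hβ : E d →L[ℝ] E d) f Ψ⟫_ℂ = 0 := by
  simp only [Distribution.IsVanishingOn, U.fourierPairing_inner hβ, mul_eq_zero,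
    pairingConst_ne_zero hβ, false_or]

lemma forall_mem_isVanishingOn_inner_iff (hβ : β.Nondegenerate) {D : Set H} (hD : Dense D)
    {Ψ : H} {s : Set (E d)} :
    (∀ Φ ∈ D, Distribution.IsVanishingOn (fourierPairing β fun x => ⟪Φ, U.toFun x Ψ⟫_ℂ) s) ↔
      ∀ f : 𝓢(E d, ℂ), tsupport f ⊆ s →
        U.smear (frequencyEquiv hβ : E d →L[ℝ] E d) f Ψ = 0 := by
  simp only [U.isVanishingOn_inner_iff hβ]
  exact ⟨fun h f hf => hD.eq_zero_of_inner_right ℂ fun Φ hΦ => h Φ hΦ f hf,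
    fun h Φ _ f hf => by rw [h f hf, inner_zero_right]⟩

lemma notMem_acSpectrum (hβ : β.Nondegenerate) {D : Set H} (hD : Dense D) {p : E d} {r : ℝ}
    (hr : 0 < r)
    (h : ∀ Ψ ∈ U.flow.continuousSubspace β K,
      (∀ Φ, FourierInL1 β fun x => ⟪Φ, U.toFun x Ψ⟫_ℂ) → ∀ Φ ∈ D,
      Distribution.IsVanishingOn (fourierPairing β fun x => ⟪Φ, U.toFun x Ψ⟫_ℂ)
        (Metric.ball p r)) :
    p ∉ U.flow.acSpectrum β K ⊤ ⊤ := by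
  rw [IsometricFlow.acSpectrum, U.flow.notMem_spectrumOn_iff hβ]
  refine ⟨r, hr, fun Ψ hΨ φ _ => ?_⟩
  obtain ⟨Φ, rfl⟩ := (InnerProductSpace.toDual ℂ H).surjective φ
  refine (U.isVanishingOn_inner_iff hβ).2 fun f hf => ?_
  let S := U.smear (frequencyEquiv hβ : E d →L[ℝ] E d) f
  have hle : U.flow.acSubspace β K ⊤ ⊤ ≤ LinearMap.ker (S : H →ₗ[ℂ] H) := by
    refine Submodule.topologicalClosure_minimal _ (Submodule.span_le.2 ?_) S.isClosed_ker
    rintro Ξ ⟨⟨-, hΞ⟩, hL⟩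
    exact (U.forall_mem_isVanishingOn_inner_iff hβ hD).1
      (h Ξ hΞ fun Φ => hL (InnerProductSpace.toDual ℂ H Φ) trivial) f hf
  have hΨ₀ : S Ψ = 0 := hle hΨ
  rw [hΨ₀, inner_zero_right]

/-- By the Riesz representation theorem the functionals on `H_sc = H_c / H_ac` are the vectors
orthogonal to `H_ac`. -/
lemma exists_inner_eq_scClass (φ : StrongDual ℂ (U.flow.ScSpace β K ⊤)) :
    ∃ Φ : H, (∀ Ψ ∈ U.flow.acSubspace β K ⊤ ⊤, ⟪Φ, Ψ⟫_ℂ = 0) ∧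
      ∀ (Ψ : U.flow.continuousSubspace β K) x,
        φ (U.flow.scClass β K ⊤ Ψ x) = ⟪Φ, U.toFun x Ψ⟫_ℂ := by
  have : CompleteSpace (U.flow.continuousSubspace β K) :=
    (U.flow.isClosed_continuousSubspace β K).completeSpace_coe
  obtain ⟨Φ, hΦ⟩ :=
    (InnerProductSpace.toDual ℂ (U.flow.continuousSubspace β K)).surjective
      (φ.comp (Submodule.mkQL _))
  have hinner : ∀ Ψ : U.flow.continuousSubspace β K,
      ⟪(Φ : H), Ψ⟫_ℂ = φ (Submodule.mkQL _ Ψ) := fun Ψ => by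
    rw [← Submodule.coe_inner, ← InnerProductSpace.toDual_apply_apply, hΦ]
    rfl
  refine ⟨Φ, fun Ψ hΨ => ?_, fun Ψ x => (hinner ⟨U.toFun x Ψ, _⟩).symm⟩
  let Ψc : U.flow.continuousSubspace β K := ⟨Ψ, U.flow.acSubspace_le_continuousSubspace _ _ hΨ⟩
  have hzero : Submodule.mkQL ((U.flow.acSubspace β K ⊤ ⊤).submoduleOf _) Ψc = 0 :=
    (Submodule.Quotient.mk_eq_zero _).2 hΨ
  exact (hinner Ψc).trans ((congrArg φ hzero).trans (_root_.map_zero φ))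

end UnitaryGroup

/-! ### Pure point spectrum -/

namespace IsometricFlow

variable {d : ℕ} {X : Type*} [NormedAddCommGroup X] [NormedSpace ℂ X] (F : IsometricFlow d X)
  {β : LinearMap.BilinForm ℝ (E d)} {K : CuboidFamily d}

lemma apply_eq_zero_of_forall_act_eq {A : X} (hA : A ∈ F.continuousSubspace β K)
    {φ : StrongDual ℂ X} (hφ : φ ∈ F.fn) {q : E d}
    (h : ∀ x, φ (F.act x A) = Complex.exp (Complex.I * (β q x : ℂ)) * φ A) : φ A = 0 := by
  refine eq_zero_of_tendsto_cuboidMean_const K ((hA q φ hφ).congr fun L => ?_)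
  congr 1
  funext x
  rw [h, ← mul_assoc, ← Complex.exp_add, neg_add_cancel, Complex.exp_zero, one_mul]

lemma ppSpectrum_eq_singleton_zero (hβ : β.Nondegenerate) {S : Submodule ℂ X} {A₀ : X}
    (hA₀ : A₀ ∈ S) (hinv : ∀ x, F.act x A₀ = A₀) {φ₀ : StrongDual ℂ X} (hφ₀ : φ₀ ∈ F.fn)
    (hne : φ₀ A₀ ≠ 0)
    (heigen : ∀ q ≠ 0, ∀ A ∈ S, (∀ φ ∈ F.fn, ∀ x, φ (F.act x A) =
      Complex.exp (Complex.I * (β q x : ℂ)) * φ A) → A = 0) :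
    F.ppSpectrum β S = {0} := by
  ext q
  rw [Set.mem_singleton_iff]
  constructor
  · rintro ⟨-, A, ⟨hAS, hsupp⟩, hA⟩
    by_contra hq
    refine hA (heigen q hq A hAS fun φ hφ x => ?_)
    have h := eq_exp_mul_of_fourierSupport_subset_singleton hβ (F.isBoundedContinuous hφ A)
      (hsupp φ hφ) x
    rwa [F.act_zero] at h
  · rintro rfl
    refine ⟨subset_closure ?_, A₀, ⟨hA₀, fun φ _ => ?_⟩, fun h => hne (by rw [h, map_zero])⟩
    · refine Set.mem_biUnion hA₀ (Set.mem_biUnion hφ₀ ?_)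
      simp only [hinv]
      exact zero_mem_fourierSupport_const hβ hne
    · simp only [hinv]
      exact fourierSupport_const_subset hβ _

end IsometricFlow

lemma eq_zero_of_forall_eq_exp_mul {d : ℕ} {β : LinearMap.BilinForm ℝ (E d)}
    (hβ : β.Nondegenerate) {q : E d} (hq : q ≠ 0) {c : ℂ}
    (h : ∀ x, c = Complex.exp (Complex.I * (β q x : ℂ)) * c) : c = 0 := by
  have hpi : β q (frequencyEquiv hβ ((2 * ‖q‖ ^ 2)⁻¹ • q)) = Real.pi := by
    rw [apply_frequencyEquiv, real_inner_smul_right, real_inner_self_eq_norm_sq]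
    field_simp
  have hneg := h (frequencyEquiv hβ ((2 * ‖q‖ ^ 2)⁻¹ • q))
  rw [hpi, mul_comm Complex.I, Complex.exp_pi_mul_I, neg_one_mul] at hneg
  exact self_eq_neg.1 hneg

section Spectra

variable {d : ℕ} {𝔄 : Type*} [CStarAlgebra 𝔄] {H : Type*} [NormedAddCommGroup H]
  [InnerProductSpace ℂ H] [CompleteSpace H] {β : LinearMap.BilinForm ℝ (E d)}
  {K : CuboidFamily d} {α : AutomorphismGroup d 𝔄} {π : 𝔄 →⋆ₐ[ℂ] (H →L[ℂ] H)} {Ω : H}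
  {ω₀ : StrongDual ℂ 𝔄} {U : UnitaryGroup d H}

lemma ppSpectrum_unitary_eq (hβ : β.Nondegenerate) (hGNS : IsGNSTriple ω₀ π Ω) (h1 : ω₀ 1 = 1)
    (hker : ∀ A, ω₀ A = 0 → A ∈ (α.flow (predual π)).continuousSubspace β K)
    (hU : Implements α π Ω U) : U.flow.ppSpectrum β ⊤ = {0} := by
  refine U.flow.ppSpectrum_eq_singleton_zero hβ (A₀ := Ω) trivial hU.invariant
    (φ₀ := InnerProductSpace.toDual ℂ H Ω) trivial ?_ fun q hq Ψ _ heigen => ?_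
  · rw [InnerProductSpace.toDual_apply_apply, hGNS.inner_self h1]
    exact one_ne_zero
  have hΩΨ : ⟪Ω, Ψ⟫_ℂ = 0 := eq_zero_of_forall_eq_exp_mul hβ hq fun x => by
    simpa only [InnerProductSpace.toDual_apply_apply, UnitaryGroup.flow_act, hU.inner_toFun]
      using heigen (InnerProductSpace.toDual ℂ H Ω) trivial x
  have hΨ := (mem_continuousSubspace_iff_inner_eq_zero hGNS h1 hker hU Ψ).2 hΩΨ
  exact inner_self_eq_zero.1 (U.flow.apply_eq_zero_of_forall_act_eq hΨ
    (φ := InnerProductSpace.toDual ℂ H Ψ) trivial (heigen _ trivial))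

lemma ppSpectrum_automorphism_eq (hβ : β.Nondegenerate) (hGNS : IsGNSTriple ω₀ π Ω)
    (h1 : ω₀ 1 = 1) (hker : ∀ A, ω₀ A = 0 → A ∈ (α.flow (predual π)).continuousSubspace β K)
    (hsep : ∀ A, (∀ φ ∈ predual π, φ A = 0) → A = 0) :
    (α.flow (predual π)).ppSpectrum β ⊤ = {0} := by
  refine (α.flow (predual π)).ppSpectrum_eq_singleton_zero hβ (A₀ := 1) trivial
    (fun x => map_one (α.toFun x)) (φ₀ := ω₀) hGNS.mem_predual (by simp [h1])
    fun q hq A _ heigen => hsep A fun φ hφ => ?_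
  have hA : ω₀ A = 0 := eq_zero_of_forall_eq_exp_mul hβ hq fun x => by
    simpa only [AutomorphismGroup.flow_act, apply_toFun_eq_of_ker_le hGNS h1 hker]
      using heigen ω₀ hGNS.mem_predual x
  exact (α.flow (predual π)).apply_eq_zero_of_forall_act_eq (hker A hA) hφ (heigen φ hφ)

lemma ppSpectrum_transposed_eq (hβ : β.Nondegenerate) (hGNS : IsGNSTriple ω₀ π Ω)
    (h1 : ω₀ 1 = 1) (hker : ∀ A, ω₀ A = 0 → A ∈ (α.flow (predual π)).continuousSubspace β K) :
    α.transposed.ppSpectrum β (predual π) = {0} := by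
  have hfn : ∀ A : 𝔄, NormedSpace.inclusionInDoubleDual ℂ 𝔄 A ∈ α.transposed.fn := fun A =>
    ⟨A, trivial, rfl⟩
  refine α.transposed.ppSpectrum_eq_singleton_zero hβ (A₀ := ω₀) hGNS.mem_predual
    (fun x => ContinuousLinearMap.ext fun A => apply_toFun_eq_of_ker_le hGNS h1 hker x A)
    (hfn 1) (by simp [h1]) fun q hq φ hφ heigen => ?_
  have heigen' : ∀ A x, φ (α.toFun x A) = Complex.exp (Complex.I * (β q x : ℂ)) * φ A :=
    fun A x => heigen _ (hfn A) x
  have hφ1 : φ 1 = 0 := eq_zero_of_forall_eq_exp_mul hβ hq fun x => by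
    simpa only [map_one] using heigen' 1 x
  ext A
  have h := (α.flow (predual π)).apply_eq_zero_of_forall_act_eq
    (hker (A - ω₀ A • 1) (by simp [h1])) hφ (heigen' _)
  simpa [hφ1] using h

lemma IsNorming.eq_zero {P : Submodule ℂ (StrongDual ℂ 𝔄)} (hP : IsNorming P) {A : 𝔄}
    (hA : ∀ φ ∈ P, φ A = 0) : A = 0 := by
  refine norm_le_zero_iff.1 ((hP A).2 ?_)
  rintro _ ⟨φ, hφ, -, rfl⟩
  rw [hA φ hφ, norm_zero]

/-! ### Absolutely continuous spectrum -/

lemma mem_continuousSubspace_transposed (h1 : ω₀ 1 = 1)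
    (hker : ∀ A, ω₀ A = 0 → A ∈ (α.flow (predual π)).continuousSubspace β K)
    {φ : StrongDual ℂ 𝔄} (hφ : φ ∈ predual π) (hφ1 : φ 1 = 0) :
    φ ∈ α.transposed.continuousSubspace β K := by
  rintro q _ ⟨A, -, rfl⟩
  refine (hker (A - ω₀ A • 1) (by simp [h1]) q φ hφ).congr fun L => ?_
  congr 1
  funext x
  congr 1
  rw [AutomorphismGroup.flow_act, map_sub, map_smul, map_one, map_sub, map_smul, hφ1, smul_zero,
    sub_zero]
  rfl

lemma Implements.vectorFunctional_right_toFun (hU : Implements α π Ω U) (Ψ : H) (x : E d)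
    (A : 𝔄) : vectorFunctional π Ψ Ω (α.toFun x A) = ⟪Ψ, U.toFun x (π A Ω)⟫_ℂ := by
  rw [vectorFunctional_apply, hU.apply_cyclic]

lemma Implements.vectorFunctional_left_toFun (hU : Implements α π Ω U) (Ψ : H) (x : E d)
    (A : 𝔄) : vectorFunctional π Ω Ψ (α.toFun x A) = ⟪π (star A) Ω, U.toFun (-x) Ψ⟫_ℂ := by
  rw [hU.vectorFunctional_toFun, hU.inner_toFun, inner_map_star_left]

lemma vectorFunctional_right_mem_acSubspace (hGNS : IsGNSTriple ω₀ π Ω) (h1 : ω₀ 1 = 1)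
    (hker : ∀ A, ω₀ A = 0 → A ∈ (α.flow (predual π)).continuousSubspace β K)
    (hU : Implements α π Ω U) (Ahat : Submodule ℂ 𝔄) {Ψ : H}
    (hΨ : Ψ ∈ U.flow.continuousSubspace β K)
    (hL : ∀ Φ : H, FourierInL1 β fun x => ⟪Φ, U.toFun x Ψ⟫_ℂ) :
    vectorFunctional π Ψ Ω ∈
      α.transposed.acSubspace β K (predual π) (AutomorphismGroup.evaluations Ahat) := by
  have hΨΩ : ⟪Ψ, Ω⟫_ℂ = 0 :=
    inner_eq_zero_symm.1 ((mem_continuousSubspace_iff_inner_eq_zero hGNS h1 hker hU Ψ).1 hΨ)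
  refine α.transposed.mem_acSubspace (vectorFunctional_mem_predual _ _)
    (mem_continuousSubspace_transposed h1 hker (vectorFunctional_mem_predual _ _)
      (by simpa using hΨΩ)) ?_
  rintro _ ⟨A, -, rfl⟩
  convert (hL (π A Ω)).neg.conj using 1
  funext x
  refine (hU.vectorFunctional_right_toFun Ψ x A).trans ?_
  rw [inner_conj_symm, U.inner_toFun_left, neg_neg]

lemma vectorFunctional_left_mem_acSubspace (hGNS : IsGNSTriple ω₀ π Ω) (h1 : ω₀ 1 = 1)
    (hker : ∀ A, ω₀ A = 0 → A ∈ (α.flow (predual π)).continuousSubspace β K)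
    (hU : Implements α π Ω U) (Ahat : Submodule ℂ 𝔄) {Ψ : H}
    (hΨ : Ψ ∈ U.flow.continuousSubspace β K)
    (hL : ∀ Φ : H, FourierInL1 β fun x => ⟪Φ, U.toFun x Ψ⟫_ℂ) :
    vectorFunctional π Ω Ψ ∈
      α.transposed.acSubspace β K (predual π) (AutomorphismGroup.evaluations Ahat) := by
  have hΩΨ : ⟪Ω, Ψ⟫_ℂ = 0 := (mem_continuousSubspace_iff_inner_eq_zero hGNS h1 hker hU Ψ).1 hΨ
  refine α.transposed.mem_acSubspace (vectorFunctional_mem_predual _ _)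
    (mem_continuousSubspace_transposed h1 hker (vectorFunctional_mem_predual _ _)
      (by simpa using hΩΨ)) ?_
  rintro _ ⟨A, -, rfl⟩
  convert (hL (π (star A) Ω)).neg using 1
  funext x
  exact hU.vectorFunctional_left_toFun Ψ x A

lemma acSpectrum_subset (hβ : β.Nondegenerate) (hGNS : IsGNSTriple ω₀ π Ω) (h1 : ω₀ 1 = 1)
    (hker : ∀ A, ω₀ A = 0 → A ∈ (α.flow (predual π)).continuousSubspace β K)
    (hU : Implements α π Ω U) (Ahat : Submodule ℂ 𝔄) :
    U.flow.acSpectrum β K ⊤ ⊤ ⊆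
      α.transposed.acSpectrum β K (predual π) (AutomorphismGroup.evaluations Ahat) := by
  intro p
  contrapose
  intro hp
  rw [IsometricFlow.acSpectrum, α.transposed.notMem_spectrumOn_iff hβ] at hp
  obtain ⟨r, hr, hvan⟩ := hp
  refine U.notMem_acSpectrum hβ hGNS.cyclic hr fun Ψ hΨ hL => Set.forall_mem_range.2 fun A => ?_
  refine U.isVanishingOn_inner_comm ?_
  simp only [← hU.vectorFunctional_right_toFun Ψ]
  exact hvan _ (vectorFunctional_right_mem_acSubspace hGNS h1 hker hU Ahat hΨ hL) _
    ⟨A, trivial, rfl⟩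

lemma neg_acSpectrum_subset (hβ : β.Nondegenerate) (hGNS : IsGNSTriple ω₀ π Ω) (h1 : ω₀ 1 = 1)
    (hker : ∀ A, ω₀ A = 0 → A ∈ (α.flow (predual π)).continuousSubspace β K)
    (hU : Implements α π Ω U) (Ahat : Submodule ℂ 𝔄) :
    -U.flow.acSpectrum β K ⊤ ⊤ ⊆
      α.transposed.acSpectrum β K (predual π) (AutomorphismGroup.evaluations Ahat) := by
  rw [Set.neg_subset]
  intro p
  rw [Set.mem_neg]
  contrapose
  intro hp
  rw [IsometricFlow.acSpectrum, α.transposed.notMem_spectrumOn_iff hβ] at hp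
  obtain ⟨r, hr, hvan⟩ := hp
  refine U.notMem_acSpectrum hβ hGNS.cyclic hr fun Ψ hΨ hL => Set.forall_mem_range.2 fun A => ?_
  convert isVanishingOn_fourierPairing_neg
    (hvan _ (vectorFunctional_left_mem_acSubspace hGNS h1 hker hU Ahat hΨ hL) _
      ⟨star A, trivial, rfl⟩) using 3 with x
  refine Eq.trans ?_ (hU.vectorFunctional_left_toFun Ψ (-x) (star A)).symm
  rw [star_star, neg_neg]

/-! ### Singular continuous spectrum -/

lemma apply_cyclic_mem_acSubspace (hβ : β.Nondegenerate) (hGNS : IsGNSTriple ω₀ π Ω)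
    (h1 : ω₀ 1 = 1)
    (hker : ∀ A, ω₀ A = 0 → A ∈ (α.flow (predual π)).continuousSubspace β K)
    (hU : Implements α π Ω U) {Phat : Submodule ℂ (StrongDual ℂ 𝔄)} {D : Set H} (hD : Dense D)
    (hDPhat : ∀ Ψ ∈ D, vectorFunctional π Ψ Ω ∈ Phat) {A : 𝔄}
    (hA : A ∈ (α.flow (predual π)).acSubspace β K ⊤ Phat) :
    π A Ω ∈ U.flow.acSubspace β K ⊤ ⊤ := by
  have hcont : Continuous (orbitMap π Ω) := (ContinuousLinearMap.apply ℂ H Ω).continuous.comp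
    (continuous_representation π)
  have hle : (α.flow (predual π)).acSubspace β K ⊤ Phat ≤
      (U.flow.acSubspace β K ⊤ ⊤).comap (orbitMap π Ω) := by
    refine Submodule.topologicalClosure_minimal _ (Submodule.span_le.2 ?_)
      ((Submodule.isClosed_topologicalClosure _).preimage hcont)
    rintro B ⟨⟨-, hB⟩, hL⟩
    refine U.flow.mem_acSubspace trivial ?_ fun φ _ => ?_
    · rw [mem_continuousSubspace_iff_inner_eq_zero hGNS h1 hker hU, orbitMap_apply, hGNS.inner_eq]
      exact (mem_continuousSubspace_iff_apply_eq_zero hGNS h1 hker B).1 hB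
    · obtain ⟨Φ, rfl⟩ := (InnerProductSpace.toDual ℂ H).surjective φ
      refine closure_minimal (fun Ψ hΨ => ?_) (U.isClosed_setOf_fourierInL1_inner hβ (π B Ω))
        (hD Φ)
      simpa only [Set.mem_ofPred_eq, AutomorphismGroup.flow_act, hU.vectorFunctional_right_toFun]
        using hL _ (hDPhat Ψ hΨ)
  exact hle hA

lemma IsGNSTriple.apply_star (hGNS : IsGNSTriple ω₀ π Ω) (A : 𝔄) : ω₀ (star A) = conj (ω₀ A) := by
  rw [← hGNS.inner_eq, ← hGNS.inner_eq, inner_map_star, inner_conj_symm]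

lemma star_mem_acSubspace (hGNS : IsGNSTriple ω₀ π Ω) (h1 : ω₀ 1 = 1)
    (hker : ∀ A, ω₀ A = 0 → A ∈ (α.flow (predual π)).continuousSubspace β K)
    {Phat : Submodule ℂ (StrongDual ℂ 𝔄)}
    (hstar : ∀ φ ∈ Phat, ∃ ψ ∈ Phat, ∀ A, ψ A = star (φ (star A))) {A : 𝔄}
    (hA : A ∈ (α.flow (predual π)).acSubspace β K ⊤ Phat) :
    star A ∈ (α.flow (predual π)).acSubspace β K ⊤ Phat := by
  have hle : (α.flow (predual π)).acSubspace β K ⊤ Phat ≤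
      ((α.flow (predual π)).acSubspace β K ⊤ Phat).comap
        (starLinearEquiv ℂ : 𝔄 ≃ₗ⋆[ℂ] 𝔄).toLinearMap := by
    refine Submodule.topologicalClosure_minimal _ (Submodule.span_le.2 ?_)
      ((Submodule.isClosed_topologicalClosure _).preimage continuous_star)
    rintro B ⟨⟨-, hB⟩, hL⟩
    have hB₀ := (mem_continuousSubspace_iff_apply_eq_zero hGNS h1 hker B).1 hB
    refine (α.flow (predual π)).mem_acSubspace trivial (hker _ ?_) fun φ hφ => ?_
    · exact (hGNS.apply_star B).trans (by rw [hB₀, map_zero])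
    · obtain ⟨ψ, hψ, hψφ⟩ := hstar φ hφ
      convert (hL ψ hψ).conj using 1
      funext x
      rw [hψφ, AutomorphismGroup.flow_act, AutomorphismGroup.flow_act, ← map_star (α.toFun x)]
      exact (star_star (φ (α.toFun x (star B)))).symm
  exact hle hA

lemma exists_forall_isVanishingOn_of_notMem_scSpectrum (hβ : β.Nondegenerate)
    {P Phat : Submodule ℂ (StrongDual ℂ 𝔄)} {p : E d}
    (hp : p ∉ (α.flow P).scSpectrum β K Phat) :
    ∃ r > 0, ∀ ψ : StrongDual ℂ 𝔄, (∀ A ∈ (α.flow P).acSubspace β K ⊤ Phat, ψ A = 0) →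
      ∀ A ∈ (α.flow P).continuousSubspace β K,
        Distribution.IsVanishingOn (fourierPairing β fun x => ψ (α.toFun x A))
          (Metric.ball p r) := by
  rw [(α.flow P).notMem_scSpectrum_iff hβ α.continuous_apply] at hp
  obtain ⟨r, hr, hvan⟩ := hp
  refine ⟨r, hr, fun ψ hψ A hA => ?_⟩
  exact hvan ⟨A, hA⟩ (Submodule.liftQL _ (ψ.comp (Submodule.subtypeL _)) fun B hB => hψ B hB)

lemma notMem_scSpectrum_unitary (hβ : β.Nondegenerate) (hGNS : IsGNSTriple ω₀ π Ω)
    (h1 : ω₀ 1 = 1) (hker : ∀ A, ω₀ A = 0 → A ∈ (α.flow (predual π)).continuousSubspace β K)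
    (hU : Implements α π Ω U) {p : E d} {r : ℝ} (hr : 0 < r)
    (h : ∀ Φ : H, (∀ Ψ ∈ U.flow.acSubspace β K ⊤ ⊤, ⟪Φ, Ψ⟫_ℂ = 0) → ∀ A, ω₀ A = 0 →
      Distribution.IsVanishingOn (fourierPairing β fun x => ⟪Φ, U.toFun x (π A Ω)⟫_ℂ)
        (Metric.ball p r)) :
    p ∉ U.flow.scSpectrum β K ⊤ := by
  rw [U.flow.notMem_scSpectrum_iff hβ U.continuous_apply]
  refine ⟨r, hr, fun Ψ φ => ?_⟩
  obtain ⟨Φ, hΦ, hφ⟩ := U.exists_inner_eq_scClass φ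
  simp only [hφ]
  refine (U.isVanishingOn_inner_iff hβ).2 fun f hf => ?_
  have hΩΨ := (mem_continuousSubspace_iff_inner_eq_zero hGNS h1 hker hU (Ψ : H)).1 Ψ.2
  refine closure_minimal (t := {Ξ : H | ⟪Φ, U.smear _ f Ξ⟫_ℂ = 0}) ?_
    (isClosed_eq (by fun_prop) continuous_const) (hGNS.mem_closure_of_inner_eq_zero h1 hΩΨ)
  rintro _ ⟨A, hA, rfl⟩
  exact (U.isVanishingOn_inner_iff hβ).1 (h Φ hΦ A hA) f hf

lemma scSpectrum_subset (hβ : β.Nondegenerate) (hGNS : IsGNSTriple ω₀ π Ω) (h1 : ω₀ 1 = 1)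
    (hker : ∀ A, ω₀ A = 0 → A ∈ (α.flow (predual π)).continuousSubspace β K)
    (hU : Implements α π Ω U) {Phat : Submodule ℂ (StrongDual ℂ 𝔄)} {D : Set H} (hD : Dense D)
    (hDPhat : ∀ Ψ ∈ D, vectorFunctional π Ψ Ω ∈ Phat) :
    U.flow.scSpectrum β K ⊤ ⊆ (α.flow (predual π)).scSpectrum β K Phat := by
  intro p
  contrapose
  intro hp
  obtain ⟨r, hr, hvan⟩ := exists_forall_isVanishingOn_of_notMem_scSpectrum hβ hp
  refine notMem_scSpectrum_unitary hβ hGNS h1 hker hU hr fun Φ hΦ A hA => ?_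
  simp only [← hU.vectorFunctional_right_toFun]
  exact hvan _ (fun B hB => hΦ _ (apply_cyclic_mem_acSubspace hβ hGNS h1 hker hU hD hDPhat hB))
    A (hker A hA)

lemma neg_scSpectrum_subset (hβ : β.Nondegenerate) (hGNS : IsGNSTriple ω₀ π Ω) (h1 : ω₀ 1 = 1)
    (hker : ∀ A, ω₀ A = 0 → A ∈ (α.flow (predual π)).continuousSubspace β K)
    (hU : Implements α π Ω U) {Phat : Submodule ℂ (StrongDual ℂ 𝔄)}
    (hstar : ∀ φ ∈ Phat, ∃ ψ ∈ Phat, ∀ A, ψ A = star (φ (star A))) {D : Set H} (hD : Dense D)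
    (hDPhat : ∀ Ψ ∈ D, vectorFunctional π Ψ Ω ∈ Phat) :
    -U.flow.scSpectrum β K ⊤ ⊆ (α.flow (predual π)).scSpectrum β K Phat := by
  rw [Set.neg_subset]
  intro p
  rw [Set.mem_neg]
  contrapose
  intro hp
  obtain ⟨r, hr, hvan⟩ := exists_forall_isVanishingOn_of_notMem_scSpectrum hβ hp
  refine notMem_scSpectrum_unitary hβ hGNS h1 hker hU hr fun Φ hΦ A hA => ?_
  have hac : ∀ B ∈ (α.flow (predual π)).acSubspace β K ⊤ Phat, vectorFunctional π Ω Φ B = 0 := by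
    intro B hB
    rw [vectorFunctional_apply, ← inner_map_star_left]
    exact inner_eq_zero_symm.1 (hΦ _ (apply_cyclic_mem_acSubspace hβ hGNS h1 hker hU hD hDPhat
      (star_mem_acSubspace hGNS h1 hker hstar hB)))
  have hA' : ω₀ (star A) = 0 := by rw [hGNS.apply_star, hA, map_zero]
  convert isVanishingOn_fourierPairing_conj (hvan _ hac (star A) (hker _ hA')) using 3 with x
  rw [hU.vectorFunctional_left_toFun, star_star, inner_conj_symm, U.inner_toFun_left, neg_neg]

end Spectra

/-! ### Transfer of spectral support by operators -/

section FourierConvolution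

variable {V : Type*} [NormedAddCommGroup V] [InnerProductSpace ℝ V] [FiniteDimensional ℝ V]
  [MeasurableSpace V] [BorelSpace V]

lemma integral_schwartzMod (z : V) (f : 𝓢(V, ℂ)) : ∫ p, schwartzMod z f p = 𝓕 f z := by
  rw [SchwartzMap.fourier_coe, Real.fourier_eq']
  simp only [schwartzMod_apply, smul_eq_mul]

/-- On the Fourier side multiplication by `f̂` is convolution with `f`, which acts on a pair of
functions as integration against the kernel `f (p - q)`. -/
lemma integral_fourier_mul_fourier_mul_fourier {f f₁ f₂ : 𝓢(V, ℂ)}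
    (hf : ∀ p q, f₁ p ≠ 0 → f₂ q ≠ 0 → f (p - q) = 1) (y z : V) :
    ∫ x, 𝓕 f x * (conj (𝓕 f₁ (y + x)) * 𝓕 f₂ (z + x)) = conj (𝓕 f₁ y) * 𝓕 f₂ z := by
  let a := schwartzMod y f₁
  let b := schwartzMod z f₂
  let c := SchwartzMap.convolution (ContinuousLinearMap.mul ℂ ℂ) f b
  have hc_fourier (x : V) : 𝓕 c x = 𝓕 f x * 𝓕 b x := by
    rw [SchwartzMap.fourier_convolution, SchwartzMap.pairing_apply_apply]
    rfl
  have hc_apply (p : V) : c p = ∫ q, f (p - q) * b q := by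
    rw [SchwartzMap.convolution_apply, convolution_eq_swap]
    rfl
  have hc_eq (p : V) (hp : f₁ p ≠ 0) : c p = ∫ q, b q := by
    rw [hc_apply]
    refine integral_congr_ae (ae_of_all _ fun q => ?_)
    by_cases hq : f₂ q = 0
    · simp only [b, schwartzMod_apply, hq, mul_zero]
    · simp only [hf p q hp hq, one_mul]
  calc ∫ x, 𝓕 f x * (conj (𝓕 f₁ (y + x)) * 𝓕 f₂ (z + x))
      = ∫ x, ⟪𝓕 a x, 𝓕 c x⟫_ℂ := by
        refine integral_congr_ae (ae_of_all _ fun x => ?_)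
        simp only [RCLike.inner_apply, hc_fourier, a, b, fourier_schwartzMod, add_comm x]
        ring
    _ = ∫ p, ⟪a p, c p⟫_ℂ := SchwartzMap.integral_inner_fourier_fourier a c
    _ = ∫ p, conj (a p) * ∫ q, b q := by
        refine integral_congr_ae (ae_of_all _ fun p => ?_)
        by_cases hp : f₁ p = 0
        · simp only [a, schwartzMod_apply, hp, mul_zero, map_zero, zero_mul, inner_zero_left]
        · simp only [RCLike.inner_apply, hc_eq p hp, mul_comm]
    _ = conj (𝓕 f₁ y) * 𝓕 f₂ z := by
        rw [integral_mul_const, integral_conj, integral_schwartzMod, integral_schwartzMod]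

lemma integrable_mul_comp_add_mul_comp_add {a b c : V → ℂ} (ha : Integrable a)
    (hb : Integrable b) (hc : Integrable c) :
    Integrable (fun q : V × V × V => a q.1 * (b (q.2.1 + q.1) * c (q.2.2 + q.1)))
      (volume.prod (volume.prod volume)) := by
  have hshear : MeasurePreserving (fun q : V × V × V => (q.1, q.2 + (q.1, q.1)))
      ((volume : Measure V).prod ((volume : Measure V).prod (volume : Measure V)))
      (volume.prod (volume.prod volume)) := by
    refine (MeasurePreserving.id volume).skew_product
      (g := fun (x : V) (m : V × V) => m + (x, x)) (by fun_prop) (ae_of_all _ fun x => ?_)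
    exact (measurePreserving_add_right
      ((volume : Measure V).prod (volume : Measure V)) (x, x)).map_eq
  exact hshear.integrable_comp_of_integrable (ha.mul_prod (hb.mul_prod hc))

end FourierConvolution

namespace UnitaryGroup

variable {d : ℕ} {H : Type*} [NormedAddCommGroup H] [InnerProductSpace ℂ H]
  (U : UnitaryGroup d H) (T : E d →L[ℝ] E d)

lemma isBoundedContinuous_inner_comp (B : H →L[ℂ] H) (Φ Ψ : H) :
    IsBoundedContinuous fun m : E d × E d => ⟪U.toFun (T m.1) Φ, B (U.toFun (T m.2) Ψ)⟫_ℂ := by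
  have hcont (Ξ : H) : Continuous fun y => U.toFun (T y) Ξ :=
    (U.continuous_apply Ξ).comp T.continuous
  refine ⟨((hcont Φ).comp continuous_fst).inner
    (B.continuous.comp ((hcont Ψ).comp continuous_snd)), ‖Φ‖ * (‖B‖ * ‖Ψ‖), fun m => ?_⟩
  calc ‖⟪U.toFun (T m.1) Φ, B (U.toFun (T m.2) Ψ)⟫_ℂ‖
      ≤ ‖U.toFun (T m.1) Φ‖ * ‖B (U.toFun (T m.2) Ψ)‖ := norm_inner_le_norm _ _
    _ ≤ ‖U.toFun (T m.1) Φ‖ * (‖B‖ * ‖U.toFun (T m.2) Ψ‖) := by gcongr; exact B.le_opNorm _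
    _ = ‖Φ‖ * (‖B‖ * ‖Ψ‖) := by rw [LinearIsometryEquiv.norm_map, LinearIsometryEquiv.norm_map]

variable [CompleteSpace H]

lemma toFun_neg_smear (f : 𝓢(E d, ℂ)) (x : E d) (Ψ : H) :
    U.toFun (-(T x)) (U.smear T f Ψ) = U.smear T (schwartzMod x f) Ψ := by
  refine ext_inner_left ℂ fun Φ => ?_
  rw [← U.inner_toFun_left, U.inner_smear, U.inner_smear, ← integral_add_right_eq_self _ x]
  refine integral_congr_ae (ae_of_all _ fun y => ?_)
  simp only [fourier_schwartzMod]
  rw [_root_.map_add T y x, add_comm (T y), U.map_add, LinearIsometryEquiv.inner_map_map]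

lemma inner_smear_apply_smear (B : H →L[ℂ] H) (f g : 𝓢(E d, ℂ)) (Φ Ψ : H) :
    ⟪U.smear T f Φ, B (U.smear T g Ψ)⟫_ℂ =
      ∫ m : E d × E d, conj (𝓕 f m.1) * 𝓕 g m.2 *
        ⟪U.toFun (T m.1) Φ, B (U.toFun (T m.2) Ψ)⟫_ℂ ∂(volume.prod volume) := by
  have hconj : Integrable fun x => conj (𝓕 f x) :=
    Complex.conjCLE.integrable_comp_iff.2 (𝓕 f).integrable
  have hint := (U.isBoundedContinuous_inner_comp T B Φ Ψ).integrable_mul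
    (μ := volume.prod volume) (hconj.mul_prod (𝓕 g).integrable)
  simp only [mul_comm ⟪_, _⟫_ℂ] at hint
  rw [integral_prod _ hint, ← inner_conj_symm, U.inner_smear, ← integral_conj]
  refine integral_congr_ae (ae_of_all _ fun y => ?_)
  simp only [map_mul, inner_conj_symm]
  rw [← ContinuousLinearMap.adjoint_inner_left, U.inner_smear, ← integral_const_mul]
  refine integral_congr_ae (ae_of_all _ fun z => ?_)
  simp only [ContinuousLinearMap.adjoint_inner_left, mul_assoc]

lemma integral_fourier_mul_inner_smear (B : H →L[ℂ] H) {f f₁ f₂ : 𝓢(E d, ℂ)}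
    (hf : ∀ p q, f₁ p ≠ 0 → f₂ q ≠ 0 → f (p - q) = 1) (Φ Ψ : H) :
    ∫ x, 𝓕 f x * ⟪U.smear T f₁ Φ, U.toFun (T x) (B (U.toFun (-(T x)) (U.smear T f₂ Ψ)))⟫_ℂ =
      ⟪U.smear T f₁ Φ, B (U.smear T f₂ Ψ)⟫_ℂ := by
  let S (m : E d × E d) : ℂ := ⟪U.toFun (T m.1) Φ, B (U.toFun (T m.2) Ψ)⟫_ℂ
  obtain ⟨hScont, C, hSbound⟩ := U.isBoundedContinuous_inner_comp T B Φ Ψ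
  have hconj : Integrable fun x => conj (𝓕 f₁ x) :=
    Complex.conjCLE.integrable_comp_iff.2 (𝓕 f₁).integrable
  have hint : Integrable (Function.uncurry fun (x : E d) (m : E d × E d) =>
      𝓕 f x * (conj (𝓕 f₁ (m.1 + x)) * 𝓕 f₂ (m.2 + x)) * S m)
      (volume.prod (volume.prod volume)) :=
    (integrable_mul_comp_add_mul_comp_add (𝓕 f).integrable hconj (𝓕 f₂).integrable).mul_bdd
      (hScont.comp continuous_snd).aestronglyMeasurable (ae_of_all _ fun q => hSbound q.2)
  calc ∫ x, 𝓕 f x * ⟪U.smear T f₁ Φ, U.toFun (T x) (B (U.toFun (-(T x)) (U.smear T f₂ Ψ)))⟫_ℂ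
      = ∫ x, ∫ m : E d × E d, 𝓕 f x * (conj (𝓕 f₁ (m.1 + x)) * 𝓕 f₂ (m.2 + x)) * S m
          ∂(volume.prod volume) := by
        refine integral_congr_ae (ae_of_all _ fun x => ?_)
        simp only
        rw [← neg_neg (T x), ← U.inner_toFun_left, neg_neg, U.toFun_neg_smear,
          U.toFun_neg_smear, U.inner_smear_apply_smear, ← integral_const_mul]
        simp only [fourier_schwartzMod, S, mul_assoc]
    _ = ∫ m : E d × E d, (∫ x, 𝓕 f x * (conj (𝓕 f₁ (m.1 + x)) * 𝓕 f₂ (m.2 + x)) * S m)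
          ∂(volume.prod volume) := integral_integral_swap hint
    _ = ∫ m : E d × E d, conj (𝓕 f₁ m.1) * 𝓕 f₂ m.2 * S m ∂(volume.prod volume) := by
        simp only [integral_mul_const, integral_fourier_mul_fourier_mul_fourier hf]
    _ = ⟪U.smear T f₁ Φ, B (U.smear T f₂ Ψ)⟫_ℂ := (U.inner_smear_apply_smear T B f₁ f₂ Φ Ψ).symm

end UnitaryGroup

section ContinuousSpectrum

variable {d : ℕ} {𝔄 : Type*} [CStarAlgebra 𝔄] {H : Type*} [NormedAddCommGroup H]
  [InnerProductSpace ℂ H] [CompleteSpace H] {β : LinearMap.BilinForm ℝ (E d)}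
  {K : CuboidFamily d} {α : AutomorphismGroup d 𝔄} {π : 𝔄 →⋆ₐ[ℂ] (H →L[ℂ] H)} {Ω : H}
  {ω₀ : StrongDual ℂ 𝔄} {U : UnitaryGroup d H}

lemma exists_smear_ne_zero (hβ : β.Nondegenerate) (hGNS : IsGNSTriple ω₀ π Ω) (h1 : ω₀ 1 = 1)
    (hker : ∀ A, ω₀ A = 0 → A ∈ (α.flow (predual π)).continuousSubspace β K)
    (hU : Implements α π Ω U) {p : E d} (hp : p ∈ U.flow.cSpectrum β K ⊤) {s : Set (E d)}
    (hs : s ∈ 𝓝 p) :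
    ∃ (f : 𝓢(E d, ℂ)) (Ψ : H), tsupport f ⊆ s ∧
      U.smear (frequencyEquiv hβ : E d →L[ℝ] E d) f Ψ ≠ 0 ∧
      ⟪Ω, U.smear (frequencyEquiv hβ : E d →L[ℝ] E d) f Ψ⟫_ℂ = 0 := by
  by_contra! hcon
  obtain ⟨r, hr, hrs⟩ := Metric.mem_nhds_iff.1 hs
  refine (U.flow.notMem_spectrumOn_iff hβ _ p).2 ⟨r, hr, fun Ψ hΨ φ _ => ?_⟩ hp
  obtain ⟨Φ, rfl⟩ := (InnerProductSpace.toDual ℂ H).surjective φ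
  refine (U.isVanishingOn_inner_iff hβ).2 fun f hf => ?_
  have hΩΨ : ⟪Ω, Ψ⟫_ℂ = 0 := (mem_continuousSubspace_iff_inner_eq_zero hGNS h1 hker hU Ψ).1 hΨ.2
  have hzero : U.smear (frequencyEquiv hβ : E d →L[ℝ] E d) f Ψ = 0 := by
    by_contra hne
    refine hcon f Ψ (hf.trans hrs) hne ?_
    rw [U.inner_smear]
    simp only [hU.inner_toFun, hΩΨ, mul_zero, integral_zero]
  rw [hzero, inner_zero_right]

/-- If `p` and `q` belong to the continuous spectrum of `U` but `p - q` not to that of `α`, then all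
`π A` with `A` in the kernel of the state annihilate matrix elements between vectors of spectral
support near `p` and `q`, against the irreducibility expressed by purity. -/
lemma cSpectrum_sub_cSpectrum_subset (hβ : β.Nondegenerate) (hω : IsPureState ω₀)
    (hGNS : IsGNSTriple ω₀ π Ω)
    (hker : ∀ A, ω₀ A = 0 → A ∈ (α.flow (predual π)).continuousSubspace β K)
    (hU : Implements α π Ω U) :
    U.flow.cSpectrum β K ⊤ - U.flow.cSpectrum β K ⊤ ⊆ (α.flow (predual π)).cSpectrum β K ⊤ := by
  rintro _ ⟨p, hp, q, hq, rfl⟩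
  have h1 : ω₀ 1 = 1 := hω.1.2
  let T : E d →L[ℝ] E d := frequencyEquiv hβ
  by_contra hpq
  rw [IsometricFlow.cSpectrum, IsometricFlow.notMem_spectrumOn_iff _ hβ] at hpq
  obtain ⟨r, hr, hvanish⟩ := hpq
  obtain ⟨f, -, hf, hf_one⟩ := exists_schwartz_eventually_eq_one (Metric.ball_mem_nhds (p - q) hr)
  have hsub := (continuous_sub.tendsto (p, q)).eventually hf_one
  rw [nhds_prod_eq, eventually_prod_iff] at hsub
  obtain ⟨nearP, hnearP, nearQ, hnearQ, hone⟩ := hsub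
  obtain ⟨f₁, Φ, hf₁, hΦ, hΦΩ⟩ := exists_smear_ne_zero hβ hGNS h1 hker hU hp hnearP
  obtain ⟨f₂, Ψ, hf₂, hΨ, hΨΩ⟩ := exists_smear_ne_zero hβ hGNS h1 hker hU hq hnearQ
  obtain ⟨A, hA, hne⟩ := hω.exists_inner_ne_zero hGNS hΦ hΨ hΦΩ hΨΩ
  have hf_sub (a b : E d) (ha : f₁ a ≠ 0) (hb : f₂ b ≠ 0) : f (a - b) = 1 :=
    hone (hf₁ (subset_tsupport _ ha)) (hf₂ (subset_tsupport _ hb))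
  have hpairing : fourierPairing β (fun x => vectorFunctional π (U.smear T f₁ Φ)
      (U.smear T f₂ Ψ) (α.toFun x A)) f = 0 :=
    hvanish A ⟨trivial, hker A hA⟩ _ (vectorFunctional_mem_predual _ _) f hf
  rw [fourierPairing_eq hβ, mul_eq_zero, or_iff_right (pairingConst_ne_zero hβ)] at hpairing
  simp only [hU.vectorFunctional_toFun, mul_comm _ (𝓕 f _)] at hpairing
  exact hne ((U.integral_fourier_mul_inner_smear T (π A) hf_sub Φ Ψ).symm.trans hpairing)

end ContinuousSpectrum

end ArvesonSpectral

end

theorem mainTheorem3_general {d : ℕ} {𝔄 : Type*} [CStarAlgebra 𝔄]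
    {H : Type*} [NormedAddCommGroup H] [InnerProductSpace ℂ H] [CompleteSpace H]
    (β : LinearMap.BilinForm ℝ (E d)) (hβ : β.Nondegenerate)
    (K : CuboidFamily d) (α : AutomorphismGroup d 𝔄)
    (ω₀ : StrongDual ℂ 𝔄) (hω₀ : IsPureState ω₀)
    (π : 𝔄 →⋆ₐ[ℂ] (H →L[ℂ] H)) (Ω : H) (hGNS : IsGNSTriple ω₀ π Ω)
    (hsep : ∀ A, (∀ φ ∈ predual π, φ A = 0) → A = 0)
    (hker : ∀ A, ω₀ A = 0 → A ∈ (α.flow (predual π)).continuousSubspace β K)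
    (Phat : Submodule ℂ (StrongDual ℂ 𝔄))
    (hstar : ∀ φ ∈ Phat, ∃ ψ ∈ Phat, ∀ A, ψ A = star (φ (star A)))
    (D : Set H) (hD : Dense D) (hDPhat : ∀ Ψ ∈ D, vectorFunctional π Ψ Ω ∈ Phat)
    (Ahat : Submodule ℂ 𝔄) :
    (∃! U : UnitaryGroup d H, Implements α π Ω U) ∧
    ∀ U : UnitaryGroup d H, Implements α π Ω U →
      (U.flow.ppSpectrum β ⊤ = {0} ∧
        (α.flow (predual π)).ppSpectrum β ⊤ = {0} ∧
        α.transposed.ppSpectrum β (predual π) = {0}) ∧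
      U.flow.cSpectrum β K ⊤ - U.flow.cSpectrum β K ⊤ ⊆
        (α.flow (predual π)).cSpectrum β K ⊤ ∧
      (U.flow.acSpectrum β K ⊤ ⊤ ⊆
          α.transposed.acSpectrum β K (predual π) (AutomorphismGroup.evaluations Ahat) ∧
        -U.flow.acSpectrum β K ⊤ ⊤ ⊆
          α.transposed.acSpectrum β K (predual π) (AutomorphismGroup.evaluations Ahat)) ∧
      (U.flow.scSpectrum β K ⊤ ⊆ (α.flow (predual π)).scSpectrum β K Phat ∧
        -U.flow.scSpectrum β K ⊤ ⊆ (α.flow (predual π)).scSpectrum β K Phat) := by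
  have h1 : ω₀ 1 = 1 := hω₀.1.2
  obtain ⟨U₀, hU₀⟩ := exists_implements hGNS (apply_toFun_eq_of_ker_le hGNS h1 hker)
  refine ⟨⟨U₀, hU₀, fun V hV => hU₀.unique hGNS.denseRange hV⟩, fun U hU => ?_⟩
  refine ⟨⟨?_, ?_, ?_⟩, ?_, ⟨?_, ?_⟩, ?_, ?_⟩
  · exact ppSpectrum_unitary_eq hβ hGNS h1 hker hU
  · exact ppSpectrum_automorphism_eq hβ hGNS h1 hker hsep
  · exact ppSpectrum_transposed_eq hβ hGNS h1 hker
  · exact cSpectrum_sub_cSpectrum_subset hβ hω₀ hGNS hker hU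
  · exact acSpectrum_subset hβ hGNS h1 hker hU Ahat
  · exact neg_acSpectrum_subset hβ hGNS h1 hker hU Ahat
  · exact scSpectrum_subset hβ hGNS h1 hker hU hD hDPhat
  · exact neg_scSpectrum_subset hβ hGNS h1 hker hU hstar hD hDPhat

theorem mainTheorem3 {d : ℕ} {𝔄 : Type*} [CStarAlgebra 𝔄]
    {H : Type*} [NormedAddCommGroup H] [InnerProductSpace ℂ H] [CompleteSpace H]
    (β : LinearMap.BilinForm ℝ (E d)) (hβ : β.Nondegenerate) (hβs : β.IsSymm)
    (K : CuboidFamily d) (α : AutomorphismGroup d 𝔄)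
    (ω₀ : StrongDual ℂ 𝔄) (hω₀ : IsPureState ω₀)
    (π : 𝔄 →⋆ₐ[ℂ] (H →L[ℂ] H)) (Ω : H) (hGNS : IsGNSTriple ω₀ π Ω)
    (hnorm : IsNorming (predual π))
    (hker : ∀ A, ω₀ A = 0 → A ∈ (α.flow (predual π)).continuousSubspace β K)
    (Phat : Submodule ℂ (StrongDual ℂ 𝔄)) (hPhat : DenseCondition π Ω Phat)
    (Ahat : Submodule ℂ 𝔄) (hAhat : Dense (Ahat : Set 𝔄)) :
    (∃! U : UnitaryGroup d H, Implements α π Ω U) ∧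
    ∀ U : UnitaryGroup d H, Implements α π Ω U →
      (U.flow.ppSpectrum β ⊤ = {0} ∧
        (α.flow (predual π)).ppSpectrum β ⊤ = {0} ∧
        α.transposed.ppSpectrum β (predual π) = {0}) ∧
      U.flow.cSpectrum β K ⊤ - U.flow.cSpectrum β K ⊤ ⊆
        (α.flow (predual π)).cSpectrum β K ⊤ ∧
      (U.flow.acSpectrum β K ⊤ ⊤ ⊆
          α.transposed.acSpectrum β K (predual π) (AutomorphismGroup.evaluations Ahat) ∧
        -U.flow.acSpectrum β K ⊤ ⊤ ⊆
          α.transposed.acSpectrum β K (predual π) (AutomorphismGroup.evaluations Ahat)) ∧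
      (U.flow.scSpectrum β K ⊤ ⊆ (α.flow (predual π)).scSpectrum β K Phat ∧
        -U.flow.scSpectrum β K ⊤ ⊆ (α.flow (predual π)).scSpectrum β K Phat) := by
  obtain ⟨D, hD, hDPhat⟩ := hPhat.vector_mem
  exact mainTheorem3_general β hβ K α ω₀ hω₀ π Ω hGNS (fun _ => hnorm.eq_zero) hker Phat
    hPhat.selfAdjoint D hD hDPhat Ahat
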